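/- Let $0<\alpha\le 2$ and let $X=(X_t)_{t\ge 0}$ be the rotationally invariant (symmetric) $\alpha$-stable Lévy process on $\mathbb{R}$, with $\mathbb{P}^x$ the probability under which $X$ starts at $x$, normalized by $\mathbb{E}^x\big[e^{i\xi (X_t-x)}\big]=e^{-t|\xi|^\alpha}$ for $t\ge 0$, $x,\xi\in\mathbb{R}$. Let $\Omega=(a,b)$ with $-\infty<a<b<\infty$, $|\Omega|=b-a$, and put $$\mathbb{H}^{(\alpha)}_{\Omega,\Omega^c}(t)=\int_\Omega \mathbb{P}^x(X_t\in\Omega^c)\,dx .$$ In the following, each $C>0$ depends only on $\alpha$ and $\Omega$, and $[x]$ is the integer part of $x$. (i) If $1<\alpha\le 2$, then for all $t>0$ $$\mathbb{H}^{(\alpha)}_{\Omega,\Omega^c}(t)=\frac{2}{\pi}\Gamma\Big(1-\frac1\alpha\Big)t^{1/\alpha}+R_\alpha(t),\qquad |R_\alpha(t)|\le C\big(t\,\mathbf 1_{(1,2)}(\alpha)+t^{3/2}\,\mathbf 1_{\{2\}}(\alpha)\big).$$ (ii) If $\alpha=1$, then for all $t>0$ $$\mathbb{H}^{(1)}_{\Omega,\Omega^c}(t)=\frac2\pi\,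 t\ln\frac1t+\frac2\pi\Big(|\Omega|\arctan\frac{t}{|\Omega|}+\frac12\, t\ln\big(t^2+|\Omega|^2\big)\Big).$$ (iii) If $0<\alpha<1$ and $1/\alpha\notin\mathbb{N}$, there is a constant $C_\alpha$ depending only on $\alpha$ (not on $\Omega$) such that for all $0<t<\min\{|\Omega|^\alpha,e^{-1}\}$ $$\mathbb{H}^{(\alpha)}_{\Omega,\Omega^c}(t)=\frac2\pi\sum_{n=1}^{[1/\alpha]}(-1)^{n-1}\frac{\Gamma(n\alpha)}{(1-n\alpha)\,n!}|\Omega|^{1-n\alpha}\sin\Big(\frac{\pi n\alpha}{2}\Big)t^n+C_\alpha t^{1/\alpha}+R_\alpha(t),\qquad |R_\alpha(t)|\le C\,t^{[1/\alpha]+1}.$$ (iv) If $\alpha=1/N$ for an integer $N\ge2$, there is a constant $C_N(\Omega)$ depending only on $N$ and $\Omega$ such that for all $0<t<\min\{|\Omega|^{1/N},e^{-1}\}$ $$\mathbb{H}^{(1/N)}_{\Omega,\Omega^c}(t)=\frac2\pi\sum_{n=1}^{N-1}(-1)^{n-1}\frac{\Gamma(n/N)}{(1-n/N)\,n!}|\Omega|^{1-n/N}\sin\Big(\frac{\pi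 n}{2N}\Big)t^n+(-1)^{N-1}\frac{2}{\pi (N-1)!}\,t^N\ln\frac1t+C_N(\Omega)\,t^N+R_{1/N}(t),$$ with $|R_{1/N}(t)|\le C\,t^{N+1}$. -/

import Mathlib

open MeasureTheory ProbabilityTheory
open scoped NNReal ENNReal

universe u

/-- A (rotationally invariant) `α`-stable Lévy process on the real line, together with the
probabilities `P x` under which it starts at `x`: its increments are independent, and the
increment over `[s, t]` has characteristic function `ξ ↦ exp (-(t - s) |ξ| ^ α)`. In particular
the increments are stationary and the process is stochastically continuous. Neither the
underlying probability space nor the regularity of the sample paths is restricted. -/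
structure StableProcess (α : ℝ) where
  /-- The sample space. -/
  Sample : Type u
  /-- The events. -/
  [mSample : MeasurableSpace Sample]
  /-- The state `X t ω` at time `t`. -/
  X : ℝ≥0 → Sample → ℝ
  /-- The probability `P x` of the process started at `x`. -/
  P : ℝ → Measure Sample
  isProbabilityMeasure_P : ∀ x, IsProbabilityMeasure (P x)
  measurable_X : ∀ t, Measurable (X t)
  start : ∀ x, ∀ᵐ ω ∂P x, X 0 ω = x
  indepIncrements : ∀ x, HasIndepIncrements X (P x)
  charFun_increment : ∀ x s t, s ≤ t → ∀ ξ : ℝ,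
    charFun ((P x).map (X t - X s)) ξ = ((Real.exp (-((t : ℝ) - s) * |ξ| ^ α) : ℝ) : ℂ)

/-- The quantity `ℍ_{A, B}(t) = ∫_A Pˣ(X_t ∈ B) dx`. -/
noncomputable def StableProcess.heat {α : ℝ} (Y : StableProcess.{u} α) (A B : Set ℝ)
    (t : ℝ≥0) : ℝ≥0∞ :=
  letI := Y.mSample
  ∫⁻ x in A, Y.P x {ω | Y.X t ω ∈ B}

open Filter Topology Set

/-! Let L = |Ω|. The points of Ω carried out of Ω by a displacement y have measure min(|y|, L), and
the law of the increment does not depend on the starting point, so by Tonelli ℍ(t) is the mean of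
min(|y|, L). Since min(|y|, L) = (2/π) ∫_0^∞ (1 - cos Lu)(1 - cos yu)/u² du, only the characteristic
function matters. Rescaling u gives ℍ(t) = (2/π) t^{1/α} S(c) with c = L t^{-1/α} and S(c) = ∫_0^∞
(1 - cos cu)(1 - exp(-u^α))/u² du (`StableProcess.toReal_heat_eq`), so small t means large c.

If 1/α is not an integer, put N = [1/α] and expand 1 - exp(-u^α) to order N. Each power u^{nα-2}
with nα < 1 has an exact transform, a multiple of c^{1-nα}, and t^{1/α} c^{1-nα} = L^{1-nα} t^n. The
remainder h is integrable. Its plain integral gives the t^{1/α} term, with a constant free of Ω, and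
one integration by parts bounds ∫ cos(cu) h(u) du by O(c^{1-(N+1)α}), that is, an error t^{N+1}
(`abs_integral_one_sub_cos_mul_sub_le`). For 1 < α < 2 this is the case N = 0, and the constant is a
Gamma value.

If α = 1/N with N ≥ 2, the N-th power becomes 1/u, whose transform diverges at infinity. Splitting
off e^{-u}/u instead, with transform (1/2) log(1 + c²), produces the logarithm. For α = 1 the
integral S is computed exactly, and for α = 2 the law is Gaussian and its third absolute moment
controls the effect of truncating |y| at L. -/

/-! ### Integrals of 1 - cos against Laplace transforms -/

lemma one_sub_cos_nonneg (x : ℝ) : 0 ≤ 1 - Real.cos x := by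
  linarith [Real.cos_le_one x]

/-- An explicit primitive tends to 0 at infinity. As the integrand is nonnegative, this limit yields
integrability as well as the value. -/
lemma laplace_one_sub_cos (c : ℝ) {v : ℝ} (hv : 0 < v) :
    IntegrableOn (fun u => (1 - Real.cos (c * u)) * Real.exp (-(v * u))) (Ioi 0) ∧
      ∫ u in Ioi (0 : ℝ), (1 - Real.cos (c * u)) * Real.exp (-(v * u))
        = c ^ 2 / (v * (v ^ 2 + c ^ 2)) := by
  have hvc : v ^ 2 + c ^ 2 ≠ 0 := by positivity
  let F : ℝ → ℝ := fun u => -Real.exp (-(v * u)) / v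
    + Real.exp (-(v * u)) * (v * Real.cos (c * u) - c * Real.sin (c * u)) / (v ^ 2 + c ^ 2)
  have hF : ∀ u ∈ Ici (0 : ℝ),
      HasDerivAt F ((1 - Real.cos (c * u)) * Real.exp (-(v * u))) u := by
    intro u _
    have h1 : HasDerivAt (fun u : ℝ => c * u) c u := by
      simpa using (hasDerivAt_id u).const_mul c
    have h2 : HasDerivAt (fun u : ℝ => -(v * u)) (-v) u := by
      simpa using ((hasDerivAt_id u).const_mul v).fun_neg
    have := (h2.exp.neg.div_const v).add
      ((h2.exp.mul ((h1.cos.const_mul v).sub (h1.sin.const_mul c))).div_const (v ^ 2 + c ^ 2))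
    refine this.congr_deriv ?_
    simp only [Pi.sub_apply]
    field_simp
    ring
  have hpos : ∀ u ∈ Ioi (0 : ℝ), 0 ≤ (1 - Real.cos (c * u)) * Real.exp (-(v * u)) :=
    fun u _ => mul_nonneg (one_sub_cos_nonneg _) (Real.exp_pos _).le
  have hexp : Tendsto (fun u : ℝ => Real.exp (-(v * u))) atTop (𝓝 0) :=
    Real.tendsto_exp_neg_atTop_nhds_zero.comp (tendsto_id.const_mul_atTop hv)
  have hlim : Tendsto F atTop (𝓝 0) := by
    have h1 : Tendsto (fun u : ℝ => -Real.exp (-(v * u)) / v) atTop (𝓝 0) := by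
      simpa using hexp.neg.div_const v
    have h2 : Tendsto (fun u : ℝ => Real.exp (-(v * u)) *
        (v * Real.cos (c * u) - c * Real.sin (c * u))) atTop (𝓝 0) := by
      refine hexp.zero_mul_isBoundedUnder_le
        ⟨|v| + |c|, eventually_map.2 (Eventually.of_forall fun u => ?_)⟩
      simp only [Function.comp, Real.norm_eq_abs]
      refine (abs_sub _ _).trans (add_le_add ?_ ?_)
      · rw [abs_mul]
        exact mul_le_of_le_one_right (abs_nonneg _) (Real.abs_cos_le_one _)
      · rw [abs_mul]
        exact mul_le_of_le_one_right (abs_nonneg _) (Real.abs_sin_le_one _)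
    simpa using h1.add (h2.div_const (v ^ 2 + c ^ 2))
  refine ⟨integrableOn_Ioi_deriv_of_nonneg' hF hpos hlim, ?_⟩
  rw [integral_Ioi_of_hasDerivAt_of_nonneg' hF hpos hlim]
  simp only [F]
  simp
  field_simp
  ring

/-- Tonelli's theorem on the open quadrant, in terms of the two inner integrals. -/
lemma integral_Ioi_swap_of_nonneg {f : ℝ → ℝ → ℝ} {g k : ℝ → ℝ}
    (hfm : Measurable (Function.uncurry f)) (hf0 : ∀ x, 0 < x → ∀ y, 0 < y → 0 ≤ f x y)
    (hg : ∀ x, 0 < x → IntegrableOn (f x) (Ioi 0) ∧ ∫ y in Ioi (0 : ℝ), f x y = g x)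
    (hgi : IntegrableOn g (Ioi 0)) (hk : ∀ y, 0 < y → ∫ x in Ioi (0 : ℝ), f x y = k y) :
    IntegrableOn k (Ioi 0) ∧ ∫ y in Ioi (0 : ℝ), k y = ∫ x in Ioi (0 : ℝ), g x := by
  have hf : Integrable (Function.uncurry f)
      ((volume.restrict (Ioi (0 : ℝ))).prod (volume.restrict (Ioi (0 : ℝ)))) := by
    rw [integrable_prod_iff hfm.aestronglyMeasurable]
    refine ⟨(ae_restrict_iff' measurableSet_Ioi).2 (Eventually.of_forall fun x hx =>
      (hg x hx).1), ?_⟩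
    refine (integrableOn_congr_fun (fun x hx => ?_) measurableSet_Ioi).2 hgi
    rw [← (hg x hx).2]
    exact setIntegral_congr_fun measurableSet_Ioi fun y hy => Real.norm_of_nonneg (hf0 x hx y hy)
  constructor
  · exact (integrableOn_congr_fun hk measurableSet_Ioi).1 hf.integral_prod_right
  · rw [← setIntegral_congr_fun measurableSet_Ioi hk,
      ← setIntegral_congr_fun measurableSet_Ioi fun x hx => (hg x hx).2, integral_integral_swap hf]

/-- Integration of `1 - cos` against a Laplace transform. -/
lemma integral_one_sub_cos_mul_laplace (c : ℝ) {w W : ℝ → ℝ} (hwm : Measurable w)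
    (hw : ∀ v, 0 < v → 0 ≤ w v)
    (hW : ∀ u, 0 < u → ∫ v in Ioi (0 : ℝ), w v * Real.exp (-(v * u)) = W u)
    (hint : IntegrableOn (fun v => w v * (c ^ 2 / (v * (v ^ 2 + c ^ 2)))) (Ioi 0)) :
    IntegrableOn (fun u => (1 - Real.cos (c * u)) * W u) (Ioi 0) ∧
      ∫ u in Ioi (0 : ℝ), (1 - Real.cos (c * u)) * W u
        = ∫ v in Ioi (0 : ℝ), w v * (c ^ 2 / (v * (v ^ 2 + c ^ 2))) := by
  refine integral_Ioi_swap_of_nonneg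
    (f := fun v u => w v * ((1 - Real.cos (c * u)) * Real.exp (-(v * u)))) ?_ ?_ ?_ hint ?_
  · simp only [Function.uncurry_def]
    fun_prop
  · exact fun v hv u _ => mul_nonneg (hw v hv)
      (mul_nonneg (one_sub_cos_nonneg _) (Real.exp_pos _).le)
  · exact fun v hv => ⟨(laplace_one_sub_cos c hv).1.const_mul (w v),
      by rw [integral_const_mul, (laplace_one_sub_cos c hv).2]⟩
  · intro u hu
    rw [← hW u hu, ← integral_const_mul]
    exact integral_congr_ae (Eventually.of_forall fun v => by ring)

/-- Write 1/(v² + 1) as ∫ exp(-(v² + 1)y) dy and integrate in v first. The two integrations give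
Γ((1-β)/2) and Γ((1+β)/2), whose product is evaluated by the reflection formula. -/
lemma integral_rpow_neg_div_one_add_sq {β : ℝ} (h1 : -1 < β) (h2 : β < 1) :
    IntegrableOn (fun v : ℝ => v ^ (-β) / (v ^ 2 + 1)) (Ioi 0) ∧
      ∫ v in Ioi (0 : ℝ), v ^ (-β) / (v ^ 2 + 1) = Real.pi / (2 * Real.cos (Real.pi * β / 2)) := by
  have hG : ∫ y in Ioi (0 : ℝ), y ^ (-((1 - β) / 2)) * Real.exp (-(1 * y))
      = Real.Gamma ((1 + β) / 2) := by
    have := Real.integral_rpow_mul_exp_neg_mul_Ioi (a := (1 + β) / 2) (r := 1) (by linarith) one_pos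
    rw [show (1 + β) / 2 - 1 = -((1 - β) / 2) by ring] at this
    simpa using this
  have key := integral_Ioi_swap_of_nonneg
    (f := fun y v => v ^ (-β) * Real.exp (-y * v ^ (2 : ℝ)) * Real.exp (-(1 * y)))
    (g := fun y => (1 / 2 * Real.Gamma ((1 - β) / 2)) *
      (y ^ (-((1 - β) / 2)) * Real.exp (-(1 * y))))
    (k := fun v => v ^ (-β) / (v ^ 2 + 1)) ?_ ?_ ?_ ?_ ?_
  · refine ⟨key.1, key.2.trans ?_⟩
    rw [integral_const_mul, hG]
    have := Real.Gamma_mul_Gamma_one_sub ((1 - β) / 2)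
    rw [show 1 - (1 - β) / 2 = (1 + β) / 2 by ring,
      show Real.pi * ((1 - β) / 2) = Real.pi / 2 - Real.pi * β / 2 by ring,
      Real.sin_pi_div_two_sub] at this
    rw [mul_assoc, this]
    ring
  · simp only [Function.uncurry_def]
    fun_prop
  · intro y _ v hv
    positivity
  · intro y hy
    refine ⟨(integrableOn_rpow_mul_exp_neg_mul_rpow (by linarith) two_pos hy).mul_const _, ?_⟩
    rw [integral_mul_const, integral_rpow_mul_exp_neg_mul_rpow two_pos (by linarith) hy,
      show -(-β + 1) / 2 = -((1 - β) / 2) by ring, show (-β + 1) / 2 = (1 - β) / 2 by ring]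
    ring
  · refine Integrable.const_mul ?_ _
    have := integrableOn_rpow_mul_exp_neg_mul_rpow (p := 1) (s := -((1 - β) / 2)) (b := 1)
      (by linarith) one_pos one_pos
    simpa [IntegrableOn] using this
  · intro v hv
    have : ∀ y : ℝ, v ^ (-β) * Real.exp (-y * v ^ (2 : ℝ)) * Real.exp (-(1 * y))
        = v ^ (-β) * Real.exp (-(v ^ 2 + 1) * y) := by
      intro y
      rw [mul_assoc, ← Real.exp_add, Real.rpow_two]
      ring_nf
    simp_rw [this]
    rw [integral_const_mul, integral_exp_mul_Ioi (by nlinarith)]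
    simp [div_eq_mul_inv, ← inv_neg]

/-- Up to the factor Γ(2-β), the weight u^{β-2} is the Laplace transform of v^{1-β}, which leads to
the preceding integral. -/
lemma integral_one_sub_cos_mul_rpow_aux {β : ℝ} (h1 : -1 < β) (h2 : β < 1) :
    IntegrableOn (fun u : ℝ => (1 - Real.cos u) * u ^ (β - 2)) (Ioi 0) ∧
      ∫ u in Ioi (0 : ℝ), (1 - Real.cos u) * u ^ (β - 2)
        = Real.pi / (2 * Real.cos (Real.pi * β / 2)) / Real.Gamma (2 - β) := by
  have hΓ : Real.Gamma (2 - β) ≠ 0 := (Real.Gamma_pos_of_pos (by linarith)).ne'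
  have hc : ∀ v ∈ Ioi (0 : ℝ), v ^ (1 - β) * ((1 : ℝ) ^ 2 / (v * (v ^ 2 + 1 ^ 2)))
      = v ^ (-β) / (v ^ 2 + 1) := by
    intro v hv
    rw [sub_eq_add_neg, add_comm, Real.rpow_add_one (ne_of_gt hv)]
    have : v ≠ 0 := ne_of_gt hv
    field_simp
  obtain ⟨hi, he⟩ := integral_rpow_neg_div_one_add_sq h1 h2
  have hW : ∀ u : ℝ, 0 < u → ∫ v in Ioi (0 : ℝ), v ^ (1 - β) * Real.exp (-(v * u))
      = u ^ (β - 2) * Real.Gamma (2 - β) := by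
    intro u hu
    have := Real.integral_rpow_mul_exp_neg_mul_Ioi (a := 2 - β) (r := u) (by linarith) hu
    rw [show 2 - β - 1 = 1 - β by ring, one_div, Real.inv_rpow hu.le, ← Real.rpow_neg hu.le,
      show -(2 - β) = β - 2 by ring] at this
    rw [← this]
    simp only [mul_comm u]
  obtain ⟨ki, ke⟩ := integral_one_sub_cos_mul_laplace 1 (by fun_prop)
    (fun v hv => by positivity) hW ((integrableOn_congr_fun hc measurableSet_Ioi).2 hi)
  rw [setIntegral_congr_fun measurableSet_Ioi hc, he] at ke
  simp only [one_mul, ← mul_assoc] at ki ke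
  rw [integral_mul_const] at ke
  refine ⟨?_, by rw [← ke]; field_simp⟩
  refine (ki.mul_const (Real.Gamma (2 - β))⁻¹).congr (Eventually.of_forall fun u => ?_)
  field_simp

lemma integral_one_sub_cos_mul_rpow {β c : ℝ} (h1 : -1 < β) (h2 : β < 1) (hc : 0 < c) :
    IntegrableOn (fun u : ℝ => (1 - Real.cos (c * u)) * u ^ (β - 2)) (Ioi 0) ∧
      ∫ u in Ioi (0 : ℝ), (1 - Real.cos (c * u)) * u ^ (β - 2)
        = c ^ (1 - β) * (Real.pi / (2 * Real.cos (Real.pi * β / 2)) / Real.Gamma (2 - β)) := by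
  obtain ⟨hi, he⟩ := integral_one_sub_cos_mul_rpow_aux h1 h2
  have h : ∀ u ∈ Ioi (0 : ℝ), c ^ (2 - β) * ((1 - Real.cos (c * u)) * (c * u) ^ (β - 2))
      = (1 - Real.cos (c * u)) * u ^ (β - 2) := by
    intro u hu
    rw [Real.mul_rpow hc.le (le_of_lt hu), show 2 - β = -(β - 2) by ring, Real.rpow_neg hc.le]
    have := (Real.rpow_pos_of_pos hc (β - 2)).ne'
    field_simp
  constructor
  · refine (integrableOn_congr_fun h measurableSet_Ioi).1 (Integrable.const_mul ?_ _)
    have := (integrableOn_Ioi_comp_mul_left_iff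
      (fun u : ℝ => (1 - Real.cos u) * u ^ (β - 2)) 0 hc).2 (by simpa using hi)
    exact this
  · rw [← setIntegral_congr_fun measurableSet_Ioi h, integral_const_mul,
      integral_comp_mul_left_Ioi (fun u : ℝ => (1 - Real.cos u) * u ^ (β - 2)) 0 hc, mul_zero, he,
      smul_eq_mul, ← mul_assoc, ← Real.rpow_neg_one, ← Real.rpow_add hc]
    ring_nf

/-- Reflection and Γ(2-β) = (1-β) Γ(1-β) bring the constant to the shape it has in the expansion.
This form needs β > 0, whereas β = 0 is used separately for the weight 1/u². -/
lemma integral_one_sub_cos_mul_rpow_eq_sin {β c : ℝ} (h1 : 0 < β) (h2 : β < 1) (hc : 0 < c) :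
    ∫ u in Ioi (0 : ℝ), (1 - Real.cos (c * u)) * u ^ (β - 2)
      = c ^ (1 - β) * (Real.Gamma β / (1 - β) * Real.sin (Real.pi * β / 2)) := by
  rw [(integral_one_sub_cos_mul_rpow (by linarith) h2 hc).2]
  congr 1
  have hpi := Real.pi_pos
  have hx : Real.pi * β / 2 < Real.pi / 2 := by nlinarith
  have hs : 0 < Real.sin (Real.pi * β / 2) :=
    Real.sin_pos_of_pos_of_lt_pi (by positivity) (by linarith)
  have hcos : 0 < Real.cos (Real.pi * β / 2) :=
    Real.cos_pos_of_mem_Ioo ⟨by nlinarith, hx⟩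
  have hG := Real.Gamma_mul_Gamma_one_sub β
  rw [show Real.pi * β = 2 * (Real.pi * β / 2) by ring, Real.sin_two_mul] at hG
  rw [show 2 - β = (1 - β) + 1 by ring, Real.Gamma_add_one (by linarith)]
  have h3 : Real.Gamma (1 - β) ≠ 0 := (Real.Gamma_pos_of_pos (by linarith)).ne'
  have h4 : 1 - β ≠ 0 := by linarith
  rw [eq_div_iff (by positivity)] at hG
  field_simp
  linarith

lemma integral_Ioi_one_div_mul_sq_add_sq (c : ℝ) :
    IntegrableOn (fun v : ℝ => c ^ 2 / (v * (v ^ 2 + c ^ 2))) (Ioi 1) ∧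
      ∫ v in Ioi (1 : ℝ), c ^ 2 / (v * (v ^ 2 + c ^ 2)) = 1 / 2 * Real.log (1 + c ^ 2) := by
  let G : ℝ → ℝ := fun v => -(1 / 2 * Real.log (1 + c ^ 2 / v ^ 2))
  have hG : ∀ v ∈ Ici (1 : ℝ), HasDerivAt G (c ^ 2 / (v * (v ^ 2 + c ^ 2))) v := by
    intro v hv
    have hv0 : 0 < v := lt_of_lt_of_le one_pos hv
    have h1 : HasDerivAt (fun v : ℝ => 1 + c ^ 2 / v ^ 2) (-(c ^ 2 * (2 * v)) / (v ^ 2) ^ 2) v := by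
      have := ((hasDerivAt_const v (c ^ 2)).div (hasDerivAt_pow 2 v) (by positivity)).const_add 1
      simpa using this
    refine ((h1.log (by positivity)).const_mul (1 / 2)).fun_neg.congr_deriv ?_
    field_simp
  have hpos : ∀ v ∈ Ioi (1 : ℝ), 0 ≤ c ^ 2 / (v * (v ^ 2 + c ^ 2)) := by
    intro v hv
    have hv0 : 0 < v := lt_trans one_pos hv
    positivity
  have hlim : Tendsto G atTop (𝓝 0) := by
    have h1 : Tendsto (fun v : ℝ => 1 + c ^ 2 / v ^ 2) atTop (𝓝 (1 + 0)) :=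
      (tendsto_const_nhds.div_atTop (tendsto_pow_atTop two_ne_zero)).const_add 1
    have := ((h1.log (by norm_num)).const_mul (1 / 2)).neg
    simpa [G] using this
  refine ⟨integrableOn_Ioi_deriv_of_nonneg' hG hpos hlim, ?_⟩
  rw [integral_Ioi_of_hasDerivAt_of_nonneg' hG hpos hlim]
  simp [G]

lemma integral_Ioi_exp_neg_mul {u : ℝ} (hu : 0 < u) :
    ∫ v in Ioi (1 : ℝ), Real.exp (-(v * u)) = Real.exp (-u) / u := by
  have := integral_exp_mul_Ioi (a := -u) (by linarith) 1
  rw [mul_one, neg_div_neg_eq] at this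
  rw [← this]
  exact integral_congr_ae (Eventually.of_forall fun v => by simp [mul_comm])

/-- The weight e^{-u}/u is the Laplace transform of the indicator of (1, ∞). This is the source of
the logarithm when α = 1/N. -/
lemma integral_one_sub_cos_mul_exp_neg_div (c : ℝ) :
    IntegrableOn (fun u => (1 - Real.cos (c * u)) * (Real.exp (-u) / u)) (Ioi 0) ∧
      ∫ u in Ioi (0 : ℝ), (1 - Real.cos (c * u)) * (Real.exp (-u) / u)
        = 1 / 2 * Real.log (1 + c ^ 2) := by
  have hsub : Ioi (0 : ℝ) ∩ Ioi 1 = Ioi 1 := by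
    rw [Ioi_inter_Ioi]
    simp
  have hind : ∀ f : ℝ → ℝ, (fun v => (Ioi (1 : ℝ)).indicator 1 v * f v) = (Ioi 1).indicator f := by
    intro f
    ext v
    by_cases hv : v ∈ Ioi (1 : ℝ) <;> simp [hv]
  obtain ⟨hi, he⟩ := integral_Ioi_one_div_mul_sq_add_sq c
  have hW : ∀ u : ℝ, 0 < u → ∫ v in Ioi (0 : ℝ), (Ioi (1 : ℝ)).indicator 1 v * Real.exp (-(v * u))
      = Real.exp (-u) / u := by
    intro u hu
    rw [hind fun v => Real.exp (-(v * u)), setIntegral_indicator measurableSet_Ioi, hsub,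
      integral_Ioi_exp_neg_mul hu]
  have hint : IntegrableOn
      (fun v => (Ioi (1 : ℝ)).indicator 1 v * (c ^ 2 / (v * (v ^ 2 + c ^ 2)))) (Ioi 0) := by
    rw [hind]
    exact (hi.integrable_indicator measurableSet_Ioi).integrableOn
  obtain ⟨ki, ke⟩ := integral_one_sub_cos_mul_laplace c
    (measurable_one.indicator measurableSet_Ioi)
    (fun v _ => indicator_nonneg (fun _ _ => zero_le_one) v) hW hint
  rw [hind, setIntegral_indicator measurableSet_Ioi, hsub, he] at ke
  exact ⟨ki, ke⟩

lemma integral_min_one_mul_exp_neg {u : ℝ} (hu : 0 < u) :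
    ∫ v in Ioi (0 : ℝ), min v 1 * Real.exp (-(v * u)) = (1 - Real.exp (-u)) / u ^ 2 := by
  have hu0 : u ≠ 0 := hu.ne'
  have h1 : ∫ v in Ioc (0 : ℝ) 1, min v 1 * Real.exp (-(v * u))
      = 1 / u ^ 2 - Real.exp (-u) * (1 / u + 1 / u ^ 2) := by
    rw [setIntegral_congr_fun (g := fun v => v * Real.exp (-(v * u))) measurableSet_Ioc
      (fun v hv => by simp only [min_eq_left hv.2]),
      ← intervalIntegral.integral_of_le zero_le_one,
      intervalIntegral.integral_eq_sub_of_hasDerivAt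
        (f := fun v => -(Real.exp (-(v * u)) * (v / u + 1 / u ^ 2)))]
    · simp
      ring
    · intro v _
      have h2 : HasDerivAt (fun v : ℝ => -(v * u)) (-u) v := by
        simpa using ((hasDerivAt_id v).mul_const u).fun_neg
      have h3 : HasDerivAt (fun v : ℝ => v / u + 1 / u ^ 2) (1 / u) v :=
        ((hasDerivAt_id v).div_const u).add_const _
      refine (h2.exp.mul h3).fun_neg.congr_deriv ?_
      field_simp
      ring
    · exact (by fun_prop : Continuous fun v => v * Real.exp (-(v * u))).intervalIntegrable _ _
  have h2 : ∀ v ∈ Ioi (1 : ℝ), min v 1 * Real.exp (-(v * u)) = Real.exp (-(v * u)) :=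
    fun v hv => by rw [min_eq_right (le_of_lt hv), one_mul]
  rw [← Ioc_union_Ioi_eq_Ioi zero_le_one, setIntegral_union (Ioc_disjoint_Ioi le_rfl)
    measurableSet_Ioi, h1, setIntegral_congr_fun measurableSet_Ioi h2, integral_Ioi_exp_neg_mul hu]
  · field_simp
    ring
  · exact (by fun_prop : Continuous fun v => min v 1 * Real.exp (-(v * u))).integrableOn_Ioc
  · refine (integrableOn_congr_fun h2 measurableSet_Ioi).2 ?_
    refine (integrableOn_exp_mul_Ioi (a := -u) (by linarith) 1).congr_fun (fun v _ => ?_)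
      measurableSet_Ioi
    simp [mul_comm]

/-- This is the integral S(c) for α = 1. Its weight is the Laplace transform of min(v, 1); the part
v ≤ 1 gives the arctangent and the part v > 1 the logarithm. -/
lemma integral_one_sub_cos_mul_one_sub_exp_neg_div_sq {c : ℝ} (hc : 0 < c) :
    ∫ u in Ioi (0 : ℝ), (1 - Real.cos (c * u)) * ((1 - Real.exp (-u)) / u ^ 2)
      = c * Real.arctan (1 / c) + 1 / 2 * Real.log (1 + c ^ 2) := by
  obtain ⟨hi, he⟩ := integral_Ioi_one_div_mul_sq_add_sq c
  have h1 : ∀ v ∈ Ioc (0 : ℝ) 1, min v 1 * (c ^ 2 / (v * (v ^ 2 + c ^ 2))) = c ^ 2 / (v ^ 2 + c ^ 2) := by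
    intro v hv
    have : v ≠ 0 := hv.1.ne'
    rw [min_eq_left hv.2]
    field_simp
  have h2 : ∀ v ∈ Ioi (1 : ℝ), min v 1 * (c ^ 2 / (v * (v ^ 2 + c ^ 2)))
      = c ^ 2 / (v * (v ^ 2 + c ^ 2)) :=
    fun v hv => by rw [min_eq_right (le_of_lt hv), one_mul]
  have hcont : Continuous fun v : ℝ => c ^ 2 / (v ^ 2 + c ^ 2) :=
    continuous_const.div (by fun_prop) fun v => by positivity
  have hI1 : IntegrableOn (fun v => min v 1 * (c ^ 2 / (v * (v ^ 2 + c ^ 2)))) (Ioc 0 1) :=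
    (integrableOn_congr_fun h1 measurableSet_Ioc).2 hcont.integrableOn_Ioc
  have hI2 : IntegrableOn (fun v => min v 1 * (c ^ 2 / (v * (v ^ 2 + c ^ 2)))) (Ioi 1) :=
    (integrableOn_congr_fun h2 measurableSet_Ioi).2 hi
  rw [(integral_one_sub_cos_mul_laplace c (w := fun v => min v 1) (by fun_prop)
    (fun v hv => le_min hv.le zero_le_one) (fun u hu => integral_min_one_mul_exp_neg hu) ?_).2]
  · rw [← Ioc_union_Ioi_eq_Ioi zero_le_one, setIntegral_union (Ioc_disjoint_Ioi le_rfl)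
      measurableSet_Ioi hI1 hI2, setIntegral_congr_fun measurableSet_Ioi h2, he,
      setIntegral_congr_fun measurableSet_Ioc h1, ← intervalIntegral.integral_of_le zero_le_one,
      intervalIntegral.integral_eq_sub_of_hasDerivAt (f := fun v => c * Real.arctan (v / c))]
    · simp
    · intro v _
      refine ((((hasDerivAt_id v).div_const c).arctan).const_mul c).congr_deriv ?_
      simp only [id]
      field_simp
      ring
    · exact hcont.intervalIntegrable _ _
  · rw [← Ioc_union_Ioi_eq_Ioi zero_le_one]
    exact hI1.union hI2

/-! ### Fourier formula for the truncated displacement -/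

lemma integral_one_sub_cos_div_sq (c : ℝ) :
    IntegrableOn (fun u : ℝ => (1 - Real.cos (c * u)) / u ^ 2) (Ioi 0) ∧
      ∫ u in Ioi (0 : ℝ), (1 - Real.cos (c * u)) / u ^ 2 = Real.pi / 2 * |c| := by
  rcases eq_or_ne c 0 with rfl | hc
  · simp
  · obtain ⟨hi, he⟩ := integral_one_sub_cos_mul_rpow (β := 0) (by norm_num) one_pos (abs_pos.2 hc)
    have h : ∀ u ∈ Ioi (0 : ℝ), (1 - Real.cos (|c| * u)) * u ^ ((0 : ℝ) - 2)
        = (1 - Real.cos (c * u)) / u ^ 2 := by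
      intro u hu
      rw [zero_sub, Real.rpow_neg (le_of_lt hu), Real.rpow_two, div_eq_mul_inv,
        ← Real.cos_abs (c * u), abs_mul, abs_of_pos (show 0 < u from hu)]
    refine ⟨(integrableOn_congr_fun h measurableSet_Ioi).1 hi, ?_⟩
    rw [← setIntegral_congr_fun measurableSet_Ioi h, he]
    simp [mul_comm]

/-- The product-to-sum formula reduces the product to single factors 1 - cos, each contributing an
absolute value; the resulting combination of |L|, |y|, |L + y| and |L - y| is the minimum. -/
lemma integral_one_sub_cos_mul_one_sub_cos_div_sq (y : ℝ) {L : ℝ} (hL : 0 ≤ L) :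
    ∫ u in Ioi (0 : ℝ), (1 - Real.cos (L * u)) * (1 - Real.cos (y * u)) / u ^ 2
      = Real.pi / 2 * min |y| L := by
  have h : ∀ u : ℝ, (1 - Real.cos (L * u)) * (1 - Real.cos (y * u)) / u ^ 2
      = (1 - Real.cos (L * u)) / u ^ 2 + (1 - Real.cos (y * u)) / u ^ 2
        - 1 / 2 * ((1 - Real.cos ((L + y) * u)) / u ^ 2)
        - 1 / 2 * ((1 - Real.cos ((L - y) * u)) / u ^ 2) := by
    intro u
    rw [add_mul L, sub_mul L, Real.cos_add, Real.cos_sub]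
    ring
  simp_rw [h]
  have h1 := integral_one_sub_cos_div_sq L
  have h2 := integral_one_sub_cos_div_sq y
  have h3 := integral_one_sub_cos_div_sq (L + y)
  have h4 := integral_one_sub_cos_div_sq (L - y)
  have h12 : IntegrableOn (fun u : ℝ => (1 - Real.cos (L * u)) / u ^ 2
      + (1 - Real.cos (y * u)) / u ^ 2) (Ioi 0) := h1.1.add h2.1
  have h123 : IntegrableOn (fun u : ℝ => (1 - Real.cos (L * u)) / u ^ 2
      + (1 - Real.cos (y * u)) / u ^ 2 - 1 / 2 * ((1 - Real.cos ((L + y) * u)) / u ^ 2)) (Ioi 0) :=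
    h12.sub (h3.1.const_mul _)
  rw [integral_sub h123 (h4.1.const_mul _),
    integral_sub h12 (h3.1.const_mul _), integral_add h1.1 h2.1,
    integral_const_mul, integral_const_mul, h1.2, h2.2, h3.2, h4.2]
  have : |L| + |y| - 1 / 2 * |L + y| - 1 / 2 * |L - y| = min |y| L := by
    rw [abs_of_nonneg hL]
    rcases abs_cases y with h | h <;> rcases abs_cases (L + y) with h' | h' <;>
      rcases abs_cases (L - y) with h'' | h'' <;> rcases min_cases |y| L with h₃ | h₃ <;> linarith
  rw [← this]
  ring

lemma integral_cos_eq_of_charFun {ν : Measure ℝ} [IsProbabilityMeasure ν] {ξ r : ℝ}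
    (h : charFun ν ξ = (r : ℂ)) : ∫ y, Real.cos (y * ξ) ∂ν = r := by
  rw [charFun_apply_real] at h
  have hint : Integrable (fun y : ℝ => Complex.exp (ξ * y * Complex.I)) ν := by
    refine (integrable_const (1 : ℝ)).mono' (by fun_prop) (Eventually.of_forall fun y => ?_)
    rw [← Complex.ofReal_mul, Complex.norm_exp_ofReal_mul_I]
  have := congrArg Complex.re h
  rw [← Complex.reCLM_apply, ← ContinuousLinearMap.integral_comp_comm _ hint,
    Complex.ofReal_re] at this
  rw [← this]
  refine integral_congr_ae (Eventually.of_forall fun y => ?_)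
  simp only [Complex.reCLM_apply]
  rw [← Complex.ofReal_mul, Complex.exp_ofReal_mul_I_re, mul_comm]

lemma integral_min_abs_eq {ν : Measure ℝ} [IsProbabilityMeasure ν] {φ : ℝ → ℝ}
    (h : ∀ ξ : ℝ, 0 < ξ → charFun ν ξ = (φ ξ : ℂ)) {L : ℝ} (hL : 0 ≤ L) :
    ∫ y, min |y| L ∂ν
      = 2 / Real.pi * ∫ u in Ioi (0 : ℝ), (1 - Real.cos (L * u)) * ((1 - φ u) / u ^ 2) := by
  let f : ℝ → ℝ → ℝ := fun y u => (1 - Real.cos (L * u)) * (1 - Real.cos (y * u)) / u ^ 2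
  have hfm : Measurable (Function.uncurry f) := by
    simp only [f, Function.uncurry_def]
    fun_prop
  have hf : Integrable (Function.uncurry f) (ν.prod (volume.restrict (Ioi (0 : ℝ)))) := by
    -- Since 1 - cos(yu) ≤ 2, the bound 2(1 - cos Lu)/u² is independent of y, so no moment of ν is
    -- needed.
    refine Integrable.mono' (((integral_one_sub_cos_div_sq L).1.const_mul 2).comp_snd ν)
      hfm.aestronglyMeasurable (Eventually.of_forall fun p => ?_)
    have h1 := one_sub_cos_nonneg (L * p.2)
    have h2 := one_sub_cos_nonneg (p.1 * p.2)
    have h3 := Real.neg_one_le_cos (p.1 * p.2)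
    simp only [f, Function.uncurry_def]
    rw [Real.norm_of_nonneg (by positivity), mul_div_assoc']
    refine div_le_div_of_nonneg_right ?_ (sq_nonneg _)
    nlinarith
  have hin : ∀ u ∈ Ioi (0 : ℝ), ∫ y, f y u ∂ν
      = (1 - Real.cos (L * u)) * ((1 - φ u) / u ^ 2) := by
    intro u hu
    have hc : Integrable (fun y => Real.cos (y * u)) ν :=
      (integrable_const (1 : ℝ)).mono' (by fun_prop)
        (Eventually.of_forall fun y => Real.abs_cos_le_one _)
    have : ∀ y, f y u = (1 - Real.cos (L * u)) / u ^ 2 * (1 - Real.cos (y * u)) := by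
      intro y
      simp only [f]
      ring
    simp_rw [this]
    rw [integral_const_mul, integral_sub (integrable_const _) hc,
      integral_cos_eq_of_charFun (h u hu)]
    simp
    ring
  rw [← setIntegral_congr_fun measurableSet_Ioi hin, ← integral_integral_swap hf]
  simp only [f, integral_one_sub_cos_mul_one_sub_cos_div_sq _ hL, integral_const_mul]
  have := Real.pi_pos
  field_simp

/-! ### From the process to the law of its increment -/

lemma volume_Ioo_inter_add_notMem {a b : ℝ} (y : ℝ) (hab : a < b) :
    volume (Ioo a b ∩ {x | x + y ∉ Ioo a b}) = ENNReal.ofReal (min |y| (b - a)) := by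
  -- The points that stay form the intersection of the interval with its translate by -y, which is
  -- empty once |y| ≥ b - a.
  have : Ioo a b ∩ {x | x + y ∉ Ioo a b} = Ioo a b \ Ioo (max a (a - y)) (min b (b - y)) := by
    ext x
    simp only [mem_inter_iff, mem_Ioo, mem_ofPred_eq, Set.mem_sdiff, max_lt_iff, lt_min_iff]
    grind
  rw [this, measure_sdiff (Ioo_subset_Ioo (le_max_left _ _) (min_le_left _ _))
    measurableSet_Ioo.nullMeasurableSet (by simp), Real.volume_Ioo, Real.volume_Ioo]
  rcases le_total 0 (min b (b - y) - max a (a - y)) with h | h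
  · rw [← ENNReal.ofReal_sub _ h]
    congr 1
    grind
  · rw [ENNReal.ofReal_of_nonpos h, tsub_zero]
    congr 1
    grind

/-- The heat content leaving an interval is the mean of the truncated displacement. -/
lemma StableProcess.exists_law_heat {α : ℝ} (Y : StableProcess.{u} α) (t : ℝ≥0) :
    ∃ ν : Measure ℝ, IsProbabilityMeasure ν ∧
      (∀ ξ : ℝ, charFun ν ξ = ((Real.exp (-(t : ℝ) * |ξ| ^ α) : ℝ) : ℂ)) ∧
      ∀ a b : ℝ, a < b →
        (Y.heat (Ioo a b) (Ioo a b)ᶜ t).toReal = ∫ y, min |y| (b - a) ∂ν := by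
  let _ := Y.mSample
  have := Y.isProbabilityMeasure_P
  have hm : Measurable (Y.X t - Y.X 0) := (Y.measurable_X t).sub (Y.measurable_X 0)
  have hprob : ∀ x, IsProbabilityMeasure ((Y.P x).map (Y.X t - Y.X 0)) :=
    fun x => Measure.isProbabilityMeasure_map hm.aemeasurable
  have hchar : ∀ x ξ : ℝ, charFun ((Y.P x).map (Y.X t - Y.X 0)) ξ
      = ((Real.exp (-(t : ℝ) * |ξ| ^ α) : ℝ) : ℂ) := by
    intro x ξ
    simpa using Y.charFun_increment x 0 t zero_le ξ
  have hlaw : ∀ x, (Y.P x).map (Y.X t - Y.X 0) = (Y.P 0).map (Y.X t - Y.X 0) := by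
    intro x
    refine Measure.ext_of_charFun (funext fun ξ => ?_)
    rw [hchar, hchar]
  refine ⟨(Y.P 0).map (Y.X t - Y.X 0), hprob 0, hchar 0, fun a b hab => ?_⟩
  set ν := (Y.P 0).map (Y.X t - Y.X 0)
  have hP : ∀ x, Y.P x {ω | Y.X t ω ∈ (Ioo a b)ᶜ}
      = ∫⁻ y, {p : ℝ × ℝ | p.1 + p.2 ∉ Ioo a b}.indicator 1 (x, y) ∂ν := by
    intro x
    have hs : MeasurableSet {y : ℝ | x + y ∉ Ioo a b} :=
      (measurableSet_Ioo.preimage (by fun_prop : Measurable fun y : ℝ => x + y)).compl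
    have h1 : Y.P x {ω | Y.X t ω ∈ (Ioo a b)ᶜ} = ν {y | x + y ∉ Ioo a b} := by
      rw [← hlaw x, Measure.map_apply hm hs]
      refine measure_congr ?_
      filter_upwards [Y.start x] with ω hω
      refine propext ?_
      change Y.X t ω ∉ Ioo a b ↔ x + (Y.X t ω - Y.X 0 ω) ∉ Ioo a b
      rw [hω, add_sub_cancel]
    rw [h1, ← lintegral_indicator_one hs]
    rfl
  have hS : MeasurableSet {p : ℝ × ℝ | p.1 + p.2 ∉ Ioo a b} :=
    (measurableSet_Ioo.preimage (by fun_prop : Measurable fun p : ℝ × ℝ => p.1 + p.2)).compl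
  have hheat : Y.heat (Ioo a b) (Ioo a b)ᶜ t = ∫⁻ y, ENNReal.ofReal (min |y| (b - a)) ∂ν := by
    unfold StableProcess.heat
    simp_rw [hP]
    rw [lintegral_lintegral_swap
      (f := fun x y => {p : ℝ × ℝ | p.1 + p.2 ∉ Ioo a b}.indicator 1 (x, y))
      (measurable_one.indicator hS).aemeasurable]
    refine lintegral_congr fun y => ?_
    have hs : MeasurableSet {x : ℝ | x + y ∉ Ioo a b} :=
      (measurableSet_Ioo.preimage (by fun_prop : Measurable fun x : ℝ => x + y)).compl
    rw [← volume_Ioo_inter_add_notMem y hab, inter_comm, ← Measure.restrict_apply hs,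
      ← lintegral_indicator_one hs]
    rfl
  rw [hheat, integral_eq_lintegral_of_nonneg_ae
    (Eventually.of_forall fun y => le_min (abs_nonneg _) (sub_nonneg.2 hab.le)) (by fun_prop)]

/-! ### Cosine transforms at high frequency -/

lemma integrableOn_Ioi_of_rpow_bounds {h : ℝ → ℝ} {A B p q : ℝ}
    (hm : AEStronglyMeasurable h (volume.restrict (Ioi 0))) (hp : -1 < p) (hq : q < -1)
    (hA : ∀ u, 0 < u → |h u| ≤ A * u ^ p) (hB : ∀ u, 0 < u → |h u| ≤ B * u ^ q) :
    IntegrableOn h (Ioi 0) := by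
  rw [← Ioc_union_Ioi_eq_Ioi zero_le_one]
  refine IntegrableOn.union ?_ ?_
  · have h1 : IntegrableOn (fun u : ℝ => u ^ p) (Ioc 0 1) :=
      (intervalIntegrable_iff_integrableOn_Ioc_of_le zero_le_one).1
        (intervalIntegral.intervalIntegrable_rpow' hp)
    exact (h1.const_mul A).mono' (hm.mono_measure (Measure.restrict_mono Ioc_subset_Ioi_self le_rfl))
      ((ae_restrict_iff' measurableSet_Ioc).2 (Eventually.of_forall fun u hu => hA u hu.1))
  · exact ((integrableOn_Ioi_rpow_of_lt hq one_pos).const_mul B).mono'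
      (hm.mono_measure (Measure.restrict_mono (Ioi_subset_Ioi zero_le_one) le_rfl))
      ((ae_restrict_iff' measurableSet_Ioi).2
        (Eventually.of_forall fun u hu => hB u (lt_trans one_pos hu)))

lemma integrableOn_abs_sin_mul_rpow {β : ℝ} (h1 : 1 < β) (h2 : β < 2) :
    IntegrableOn (fun u : ℝ => |Real.sin u| * u ^ (β - 3)) (Ioi 0) := by
  refine integrableOn_Ioi_of_rpow_bounds (A := 1) (B := 1) (p := β - 2) (q := β - 3)
    (by fun_prop) (by linarith) (by linarith) (fun u hu => ?_) (fun u hu => ?_)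
  · rw [abs_mul, abs_abs, abs_of_nonneg (Real.rpow_nonneg hu.le _),
      show β - 2 = 1 + (β - 3) by ring, Real.rpow_add hu, Real.rpow_one, one_mul]
    gcongr
    exact Real.abs_sin_le_abs.trans_eq (abs_of_pos hu)
  · rw [abs_mul, abs_abs, abs_of_nonneg (Real.rpow_nonneg hu.le _)]
    gcongr
    exact Real.abs_sin_le_one u

lemma integral_abs_sin_mul_rpow {β c : ℝ} (h1 : 1 < β) (h2 : β < 2) (hc : 0 < c) :
    IntegrableOn (fun u : ℝ => |Real.sin (c * u)| * u ^ (β - 3)) (Ioi 0) ∧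
      ∫ u in Ioi (0 : ℝ), |Real.sin (c * u)| * u ^ (β - 3)
        = c ^ (2 - β) * ∫ u in Ioi (0 : ℝ), |Real.sin u| * u ^ (β - 3) := by
  have hi := integrableOn_abs_sin_mul_rpow h1 h2
  have h : ∀ u ∈ Ioi (0 : ℝ), c ^ (3 - β) * (|Real.sin (c * u)| * (c * u) ^ (β - 3))
      = |Real.sin (c * u)| * u ^ (β - 3) := by
    intro u hu
    rw [Real.mul_rpow hc.le (le_of_lt hu), show 3 - β = -(β - 3) by ring, Real.rpow_neg hc.le]
    have := (Real.rpow_pos_of_pos hc (β - 3)).ne'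
    field_simp
  constructor
  · refine (integrableOn_congr_fun h measurableSet_Ioi).1 (Integrable.const_mul ?_ _)
    exact (integrableOn_Ioi_comp_mul_left_iff
      (fun u : ℝ => |Real.sin u| * u ^ (β - 3)) 0 hc).2 (by simpa using hi)
  · rw [← setIntegral_congr_fun measurableSet_Ioi h, integral_const_mul,
      integral_comp_mul_left_Ioi (fun u : ℝ => |Real.sin u| * u ^ (β - 3)) 0 hc, mul_zero,
      smul_eq_mul, ← mul_assoc, ← Real.rpow_neg_one, ← Real.rpow_add hc]
    ring_nf

lemma tendsto_zero_of_abs_le_rpow {f : ℝ → ℝ} {A p q : ℝ} (hp : 0 < p) (hq : q < 0)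
    (h0 : ∀ u, 0 < u → |f u| ≤ A * u ^ p) (h1 : ∀ u, 0 < u → |f u| ≤ A * u ^ q) :
    Tendsto f (𝓝[>] 0) (𝓝 0) ∧ Tendsto f atTop (𝓝 0) := by
  constructor
  · refine squeeze_zero_norm' (a := fun u => A * u ^ p)
      (eventually_mem_nhdsWithin.mono fun u hu => h0 u hu) ?_
    have : Tendsto (fun u : ℝ => A * u ^ p) (𝓝 0) (𝓝 (A * 0 ^ p)) :=
      ((Real.continuousAt_rpow_const 0 p (Or.inr hp.le)).tendsto).const_mul A
    rw [Real.zero_rpow hp.ne', mul_zero] at this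
    exact this.mono_left nhdsWithin_le_nhds
  · refine squeeze_zero_norm' (a := fun u => A * u ^ q)
      ((eventually_gt_atTop 0).mono fun u hu => h1 u hu) ?_
    have := (tendsto_rpow_neg_atTop (y := -q) (by linarith)).const_mul A
    simpa using this

/-- The decay of a cosine transform of a function with power bounds. -/
lemma abs_integral_one_sub_cos_mul_sub_le {h h' : ℝ → ℝ} {A B β γ c : ℝ} (hβ1 : 1 < β)
    (hβ2 : β < 2) (hγ : γ < 1) (hc : 0 < c) (hd : ∀ u, 0 < u → HasDerivAt h (h' u) u)
    (hA : ∀ u, 0 < u → |h u| ≤ A * u ^ (β - 2)) (hB : ∀ u, 0 < u → |h u| ≤ B * u ^ (γ - 2))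
    (hA' : ∀ u, 0 < u → |h' u| ≤ A * u ^ (β - 3)) :
    IntegrableOn (fun u => (1 - Real.cos (c * u)) * h u) (Ioi 0) ∧
    |(∫ u in Ioi (0 : ℝ), (1 - Real.cos (c * u)) * h u) - ∫ u in Ioi (0 : ℝ), h u|
      ≤ A * (∫ u in Ioi (0 : ℝ), |Real.sin u| * u ^ (β - 3)) * c ^ (1 - β) := by
  -- The sign of A is read off from the bound on h at u = 1.
  have hA0 : 0 ≤ A := by
    have := (abs_nonneg _).trans (hA 1 one_pos)
    simpa using this
  have hcont : ContinuousOn h (Ioi 0) := fun u hu => (hd u hu).continuousAt.continuousWithinAt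
  have hi : IntegrableOn h (Ioi 0) :=
    integrableOn_Ioi_of_rpow_bounds (hcont.aestronglyMeasurable measurableSet_Ioi)
      (by linarith) (by linarith) hA hB
  have hcos : IntegrableOn (fun u => h u * Real.cos (c * u)) (Ioi 0) :=
    hi.mul_bdd (c := 1) (by fun_prop) (Eventually.of_forall fun u => Real.abs_cos_le_one _)
  obtain ⟨si, se⟩ := integral_abs_sin_mul_rpow hβ1 hβ2 hc
  have hbound : ∀ u ∈ Ioi (0 : ℝ), ‖h' u * (Real.sin (c * u) / c)‖
      ≤ A / c * (|Real.sin (c * u)| * u ^ (β - 3)) := by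
    intro u hu
    rw [norm_mul, norm_div, Real.norm_eq_abs, Real.norm_eq_abs, Real.norm_of_nonneg hc.le]
    calc |h' u| * (|Real.sin (c * u)| / c)
        ≤ A * u ^ (β - 3) * (|Real.sin (c * u)| / c) := by gcongr; exact hA' u hu
      _ = _ := by ring
  have hm' : AEStronglyMeasurable h' (volume.restrict (Ioi 0)) := by
    refine (measurable_deriv h).aestronglyMeasurable.congr ?_
    exact (ae_restrict_iff' measurableSet_Ioi).2 (Eventually.of_forall fun u hu => (hd u hu).deriv)
  have hae := (ae_restrict_iff' (μ := volume) measurableSet_Ioi).2 (Eventually.of_forall hbound)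
  have hi' : IntegrableOn (fun u => h' u * (Real.sin (c * u) / c)) (Ioi 0) :=
    (si.const_mul (A / c)).mono' (hm'.mul (by fun_prop)) hae
  have hv : ∀ u ∈ Ioi (0 : ℝ), HasDerivAt (fun u => Real.sin (c * u) / c) (Real.cos (c * u)) u := by
    intro u _
    have h1 : HasDerivAt (fun u : ℝ => c * u) c u := by
      simpa using (hasDerivAt_id u).const_mul c
    refine (h1.sin.div_const c).congr_deriv ?_
    field_simp
  -- The boundary terms of the integration by parts vanish: |sin(cu)|/c ≤ u gives u^{β-1} at 0, and
  -- |sin(cu)|/c ≤ 1/c gives u^{β-2} at infinity. The maximum makes one constant serve both bounds.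
  have hlim := tendsto_zero_of_abs_le_rpow (f := h * fun u => Real.sin (c * u) / c)
    (A := A * max 1 (1 / c)) (p := β - 1) (q := β - 2) (by linarith) (by linarith)
    (fun u hu => ?_) (fun u hu => ?_)
  · have key := integral_Ioi_mul_deriv_eq_deriv_mul (u := h) (fun u hu => hd u hu) hv hcos hi'
      hlim.1 hlim.2
    have e : ∫ u in Ioi (0 : ℝ), (1 - Real.cos (c * u)) * h u
        = (∫ u in Ioi (0 : ℝ), h u) - ∫ u in Ioi (0 : ℝ), h u * Real.cos (c * u) := by
      rw [← integral_sub hi hcos]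
      exact integral_congr_ae (Eventually.of_forall fun u => by ring)
    refine ⟨(hi.sub hcos).congr (Eventually.of_forall fun u => ?_), ?_⟩
    · simp only [Pi.sub_apply]
      ring
    rw [e, key, sub_self, zero_sub, sub_neg_eq_add, add_sub_cancel_left, ← Real.norm_eq_abs]
    refine (norm_integral_le_of_norm_le (si.const_mul (A / c)) hae).trans_eq ?_
    rw [integral_const_mul, se, show 2 - β = 1 + (1 - β) by ring, Real.rpow_add hc, Real.rpow_one]
    field_simp
  · rw [Pi.mul_apply, abs_mul, abs_div, abs_of_pos hc, show β - 1 = (β - 2) + 1 by ring,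
      Real.rpow_add_one hu.ne']
    calc |h u| * (|Real.sin (c * u)| / c) ≤ A * u ^ (β - 2) * ((c * u) / c) := by
          gcongr
          · exact hA u hu
          · exact Real.abs_sin_le_abs.trans_eq (abs_of_pos (mul_pos hc hu))
      _ = A * 1 * (u ^ (β - 2) * u) := by field_simp
      _ ≤ _ := by
          gcongr
          exact le_max_left _ _
  · rw [Pi.mul_apply, abs_mul, abs_div, abs_of_pos hc]
    calc |h u| * (|Real.sin (c * u)| / c) ≤ A * u ^ (β - 2) * (1 / c) := by
          gcongr
          · exact hA u hu
          · exact Real.abs_sin_le_one _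
      _ = A * (1 / c) * u ^ (β - 2) := by ring
      _ ≤ _ := by
          gcongr
          exact le_max_right _ _

/-! ### Taylor remainders of the exponential -/

/-- The Taylor polynomial of degree `N - 1` of `exp (-s)`, minus `exp (-s)`. -/
noncomputable def expTaylorDefect (N : ℕ) (s : ℝ) : ℝ :=
  ∑ n ∈ Finset.range N, (-s) ^ n / (n.factorial : ℝ) - Real.exp (-s)

lemma expTaylorDefect_succ (N : ℕ) (s : ℝ) :
    expTaylorDefect (N + 1) s = expTaylorDefect N s + (-s) ^ N / (N.factorial : ℝ) := by
  simp only [expTaylorDefect, Finset.sum_range_succ]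
  ring

lemma hasDerivAt_expTaylorDefect_succ (N : ℕ) (s : ℝ) :
    HasDerivAt (expTaylorDefect (N + 1)) (-expTaylorDefect N s) s := by
  induction N with
  | zero =>
    have : HasDerivAt (fun s : ℝ => 1 - Real.exp (-s)) (Real.exp (-s)) s := by
      simpa using ((hasDerivAt_neg s).exp.const_sub 1)
    refine (this.congr_of_eventuallyEq (Eventually.of_forall fun x => ?_)).congr_deriv ?_ <;>
      simp [expTaylorDefect]
  | succ N ih =>
    have h1 : HasDerivAt (fun s : ℝ => (-s) ^ (N + 1) / ((N + 1).factorial : ℝ))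
        (-((-s) ^ N / (N.factorial : ℝ))) s := by
      refine (((hasDerivAt_neg s).fun_pow (N + 1)).div_const _).congr_deriv ?_
      rw [Nat.factorial_succ]
      push_cast
      have : (N.factorial : ℝ) ≠ 0 := by positivity
      simp
      field_simp
    refine ((ih.fun_add h1).congr_of_eventuallyEq (Eventually.of_forall fun x =>
      expTaylorDefect_succ (N + 1) x)).congr_deriv ?_
    rw [expTaylorDefect_succ]
    ring

lemma expTaylorDefect_succ_zero (N : ℕ) : expTaylorDefect (N + 1) 0 = 0 := by
  simp [expTaylorDefect, Finset.sum_range_succ']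

/-- Induction on N: up to sign, differentiation lowers the index of the defect by one, so the mean
value inequality integrates the previous bound. -/
lemma abs_expTaylorDefect_le (N : ℕ) : ∀ s, 0 ≤ s →
    |expTaylorDefect N s| ≤ s ^ N / (N.factorial : ℝ) := by
  induction N with
  | zero =>
    intro s hs
    simp [expTaylorDefect, hs]
  | succ N ih =>
    intro s hs
    have hB : ∀ x : ℝ, HasDerivAt (fun x : ℝ => x ^ (N + 1) / ((N + 1).factorial : ℝ))
        (x ^ N / (N.factorial : ℝ)) x := by
      intro x
      refine ((hasDerivAt_pow (N + 1) x).div_const _).congr_deriv ?_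
      rw [Nat.factorial_succ]
      push_cast
      have : (N.factorial : ℝ) ≠ 0 := by positivity
      field_simp
    refine image_norm_le_of_norm_deriv_right_le_deriv_boundary (f := expTaylorDefect (N + 1))
      (f' := fun x => -expTaylorDefect N x) (a := 0) (b := s)
      (fun x _ => (hasDerivAt_expTaylorDefect_succ N x).continuousAt.continuousWithinAt)
      (fun x _ => (hasDerivAt_expTaylorDefect_succ N x).hasDerivWithinAt) ?_ hB
      (fun x hx => ?_) ⟨hs, le_rfl⟩
    · simp [expTaylorDefect_succ_zero]
    · rw [norm_neg]
      exact ih x hx.1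

/-- This bound is one power weaker than the preceding one; it is the better one for large s and
gives integrability at infinity. -/
lemma abs_expTaylorDefect_succ_le (N : ℕ) {s : ℝ} (hs : 0 ≤ s) :
    |expTaylorDefect (N + 1) s| ≤ 2 * s ^ N / (N.factorial : ℝ) := by
  rw [expTaylorDefect_succ]
  refine (abs_add_le _ _).trans ?_
  rw [abs_div, abs_pow, abs_neg, abs_of_nonneg hs, Nat.abs_cast, mul_div_assoc, two_mul]
  gcongr
  exact abs_expTaylorDefect_le N s hs

/-! ### The Gaussian case α = 2 -/

lemma integral_abs_rpow_gaussianReal {v : ℝ≥0} (hv : v ≠ 0) {q : ℝ} (hq : -1 < q) :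
    ∫ y, |y| ^ q ∂gaussianReal 0 v
      = (√(2 * Real.pi * v))⁻¹ * ((1 / (2 * v : ℝ)) ^ (-(q + 1) / 2) * Real.Gamma ((q + 1) / 2)) := by
  have hv' : (0 : ℝ) < v := by positivity
  rw [integral_gaussianReal_eq_integral_smul hv]
  let f : ℝ → ℝ := fun y => (√(2 * Real.pi * v))⁻¹ *
    (y ^ q * Real.exp (-(1 / (2 * v : ℝ)) * y ^ (2 : ℝ)))
  have h : ∀ y : ℝ, gaussianPDFReal 0 v y • |y| ^ q = f |y| := by
    intro y
    simp only [f, gaussianPDFReal, smul_eq_mul, Real.rpow_two, sq_abs, sub_zero]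
    rw [show -y ^ 2 / (2 * (v : ℝ)) = -(1 / (2 * (v : ℝ))) * y ^ 2 by ring]
    ring
  rw [integral_congr_ae (Eventually.of_forall h), integral_comp_abs, integral_const_mul,
    integral_rpow_mul_exp_neg_mul_rpow two_pos hq (by positivity)]
  ring

lemma integrable_abs_pow_gaussianReal (v : ℝ≥0) (n : ℕ) :
    Integrable (fun y : ℝ => |y| ^ n) (gaussianReal 0 v) := by
  have := (memLp_id_gaussianReal (μ := 0) (v := v) n).integrable_norm_pow'
  simpa using this

/-- Truncation at L changes |y| only where |y| > L, and there by at most |y|³/L². The first absolute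
moment is thus the main term and the third one the error. -/
lemma abs_integral_min_abs_gaussianReal_sub_le {t : ℝ≥0} (ht : 0 < t) {L : ℝ} (hL : 0 < L) :
    |∫ y, min |y| L ∂gaussianReal 0 (2 * t) - 2 / √Real.pi * (t : ℝ) ^ (1 / 2 : ℝ)|
      ≤ 8 / √Real.pi / L ^ 2 * (t : ℝ) ^ (3 / 2 : ℝ) := by
  have ht' : (0 : ℝ) < t := by positivity
  have hv : 2 * t ≠ 0 := by positivity
  have hsq : √(2 * Real.pi * (2 * (t : ℝ))) = 2 * √Real.pi * √(t : ℝ) := by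
    rw [show 2 * Real.pi * (2 * (t : ℝ)) = 2 ^ 2 * Real.pi * t by ring,
      Real.sqrt_mul (by positivity), Real.sqrt_mul (by positivity), Real.sqrt_sq zero_le_two]
  have hpi : √Real.pi ≠ 0 := by positivity
  have hst : √(t : ℝ) ≠ 0 := by positivity
  have hst2 : √(t : ℝ) ^ 2 = t := Real.sq_sqrt ht'.le
  have e1 : ∫ y, |y| ∂gaussianReal 0 (2 * t) = 2 / √Real.pi * (t : ℝ) ^ (1 / 2 : ℝ) := by
    have := integral_abs_rpow_gaussianReal hv (q := 1) (by norm_num)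
    simp only [Real.rpow_one] at this
    rw [this, ← Real.sqrt_eq_rpow]
    push_cast
    rw [hsq]
    norm_num [Real.rpow_neg_one, Real.Gamma_one]
    field_simp
    rw [hst2]
  have e3 : ∫ y, |y| ^ 3 ∂gaussianReal 0 (2 * t) = 8 / √Real.pi * (t : ℝ) ^ (3 / 2 : ℝ) := by
    have := integral_abs_rpow_gaussianReal hv (q := 3) (by norm_num)
    simp only [show (3 : ℝ) = ((3 : ℕ) : ℝ) by norm_num, Real.rpow_natCast] at this
    rw [this, show (3 / 2 : ℝ) = 1 + 1 / 2 by norm_num, Real.rpow_add ht', Real.rpow_one,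
      ← Real.sqrt_eq_rpow]
    push_cast
    rw [hsq, show (-(3 + 1) / 2 : ℝ) = -((2 : ℕ) : ℝ) by norm_num, Real.rpow_neg (by positivity),
      Real.rpow_natCast, show ((3 : ℝ) + 1) / 2 = 1 + 1 by norm_num, Real.Gamma_add_one one_ne_zero,
      Real.Gamma_one]
    field_simp
    rw [hst2]
    ring
  have i1 : Integrable (fun y : ℝ => |y|) (gaussianReal 0 (2 * t)) := by
    simpa using integrable_abs_pow_gaussianReal (2 * t) 1
  have i3 := integrable_abs_pow_gaussianReal (2 * t) 3
  have im : Integrable (fun y : ℝ => min |y| L) (gaussianReal 0 (2 * t)) := by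
    refine i1.mono' (by fun_prop) (Eventually.of_forall fun y => ?_)
    rw [Real.norm_of_nonneg (le_min (abs_nonneg _) hL.le)]
    exact min_le_left _ _
  rw [← e1, ← integral_sub im i1, ← Real.norm_eq_abs]
  refine (norm_integral_le_of_norm_le (i3.div_const (L ^ 2))
    (Eventually.of_forall fun y => ?_)).trans_eq ?_
  · have h0 := abs_nonneg y
    rw [Real.norm_eq_abs, abs_of_nonpos (by linarith [min_le_left |y| L]), le_div_iff₀ (by positivity)]
    rcases le_total |y| L with h | h
    · rw [min_eq_left h]
      simp only [sub_self, neg_zero, zero_mul]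
      positivity
    · rw [min_eq_right h]
      have : L ^ 2 ≤ |y| ^ 2 := by gcongr
      nlinarith
  · rw [integral_div, e3]
    ring

/-! ### The scaled integral and its expansion for large c -/

/-- The heat content at unit time, up to the factor `2 / π`, of an interval of length `c`. -/
noncomputable def stableIntegral (α c : ℝ) : ℝ :=
  ∫ u in Ioi (0 : ℝ), (1 - Real.cos (c * u)) * ((1 - Real.exp (-u ^ α)) / u ^ 2)

lemma StableProcess.toReal_heat_eq {α : ℝ} (hα : 0 < α) (Y : StableProcess.{u} α) {a b : ℝ}
    (hab : a < b) {t : ℝ≥0} (ht : 0 < t) :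
    (Y.heat (Ioo a b) (Ioo a b)ᶜ t).toReal
      = 2 / Real.pi * ((t : ℝ) ^ (1 / α)
        * stableIntegral α ((b - a) * (t : ℝ) ^ (-(1 / α)))) := by
  obtain ⟨ν, hν, hchar, hheat⟩ := Y.exists_law_heat t
  have ht' : (0 : ℝ) < t := by positivity
  have hb : 0 < (t : ℝ) ^ (1 / α) := Real.rpow_pos_of_pos ht' _
  rw [hheat a b hab, integral_min_abs_eq (fun ξ _ => hchar ξ) (sub_nonneg.2 hab.le)]
  congr 1
  have key := integral_comp_mul_left_Ioi (fun u : ℝ =>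
    (1 - Real.cos ((b - a) * (t : ℝ) ^ (-(1 / α)) * u)) * ((1 - Real.exp (-u ^ α)) / u ^ 2)) 0 hb
  rw [mul_zero, smul_eq_mul, eq_comm, inv_mul_eq_iff_eq_mul₀ hb.ne'] at key
  rw [stableIntegral, key, ← mul_assoc, ← sq, ← integral_const_mul]
  refine setIntegral_congr_fun measurableSet_Ioi fun u hu => ?_
  have hu' : 0 < u := hu
  rw [abs_of_pos hu', Real.mul_rpow hb.le hu'.le, ← Real.rpow_mul ht'.le, one_div_mul_cancel hα.ne',
    Real.rpow_one, Real.rpow_neg ht'.le]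
  have e : (b - a) * ((t : ℝ) ^ (1 / α))⁻¹ * ((t : ℝ) ^ (1 / α) * u) = (b - a) * u := by
    field_simp
  rw [e, neg_mul]
  field_simp

lemma one_sub_exp_neg_eq_sum (N : ℕ) (s : ℝ) :
    1 - Real.exp (-s) = ∑ n ∈ Finset.Icc 1 N, (-1) ^ (n - 1) * s ^ n / (n.factorial : ℝ)
      + expTaylorDefect (N + 1) s := by
  induction N with
  | zero => simp [expTaylorDefect]
  | succ N ih =>
    rw [ih, Finset.sum_Icc_succ_top (by omega), expTaylorDefect_succ (N + 1), Nat.add_sub_cancel,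
      neg_pow s (N + 1)]
    ring

lemma stableIntegral_eq_sum_add {α c : ℝ} {N : ℕ} (hα : 0 < α) (hN : N * α < 1) (hc : 0 < c) :
    stableIntegral α c = ∑ n ∈ Finset.Icc 1 N, (-1) ^ (n - 1) / (n.factorial : ℝ)
        * (c ^ (1 - n * α) * (Real.Gamma (n * α) / (1 - n * α) * Real.sin (Real.pi * (n * α) / 2)))
      + ∫ u in Ioi (0 : ℝ), (1 - Real.cos (c * u)) * (expTaylorDefect (N + 1) (u ^ α) / u ^ 2) := by
  have hn : ∀ n ∈ Finset.Icc 1 N, 0 < n * α ∧ n * α < 1 := by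
    intro n hn
    rw [Finset.mem_Icc] at hn
    have h1 : (1 : ℝ) ≤ n := by exact_mod_cast hn.1
    have h2 : (n : ℝ) ≤ N := by exact_mod_cast hn.2
    exact ⟨by positivity, lt_of_le_of_lt (by gcongr) hN⟩
  let g : ℕ → ℝ → ℝ := fun n u =>
    (-1) ^ (n - 1) / (n.factorial : ℝ) * ((1 - Real.cos (c * u)) * u ^ ((n * α : ℝ) - 2))
  have hg : ∀ n ∈ Finset.Icc 1 N, IntegrableOn (g n) (Ioi 0) := fun n hn' =>
    (integral_one_sub_cos_mul_rpow (by linarith [(hn n hn').1]) (hn n hn').2 hc).1.const_mul _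
  have hs : IntegrableOn (fun u => ∑ n ∈ Finset.Icc 1 N, g n u) (Ioi 0) :=
    integrable_finsetSum _ hg
  have h0 : IntegrableOn
      (fun u => (1 - Real.cos (c * u)) * ((1 - Real.exp (-u ^ α)) / u ^ 2)) (Ioi 0) := by
    refine (integral_one_sub_cos_div_sq c).1.mono' (by fun_prop)
      ((ae_restrict_iff' measurableSet_Ioi).2 (Eventually.of_forall fun u hu => ?_))
    have hu' : 0 ≤ u ^ α := Real.rpow_nonneg (le_of_lt hu) _
    have h1 : Real.exp (-u ^ α) ≤ 1 := Real.exp_le_one_iff.2 (by linarith)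
    have h2 := one_sub_cos_nonneg (c * u)
    have h3 : 0 ≤ 1 - Real.exp (-u ^ α) := by linarith
    rw [Real.norm_of_nonneg (by positivity), mul_div_assoc']
    refine div_le_div_of_nonneg_right ?_ (sq_nonneg _)
    nlinarith [Real.exp_pos (-u ^ α)]
  have hpt : ∀ u ∈ Ioi (0 : ℝ), (1 - Real.cos (c * u)) * ((1 - Real.exp (-u ^ α)) / u ^ 2)
      = ∑ n ∈ Finset.Icc 1 N, g n u
        + (1 - Real.cos (c * u)) * (expTaylorDefect (N + 1) (u ^ α) / u ^ 2) := by
    intro u hu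
    rw [one_sub_exp_neg_eq_sum N, add_div, mul_add, Finset.sum_div, Finset.mul_sum]
    congr 1
    refine Finset.sum_congr rfl fun n _ => ?_
    simp only [g]
    rw [Real.rpow_sub hu, Real.rpow_two, mul_comm (n : ℝ) α, Real.rpow_mul (le_of_lt hu),
      Real.rpow_natCast]
    ring
  -- The full integrand and the finite sum are integrable, hence so is their difference.
  have hr : IntegrableOn
      (fun u => (1 - Real.cos (c * u)) * (expTaylorDefect (N + 1) (u ^ α) / u ^ 2)) (Ioi 0) := by
    refine (integrableOn_congr_fun (fun u hu => ?_) measurableSet_Ioi).1 (h0.sub hs)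
    simp only [Pi.sub_apply]
    rw [hpt u hu]
    ring
  rw [stableIntegral, setIntegral_congr_fun measurableSet_Ioi hpt, integral_add hs hr,
    integral_finsetSum _ hg]
  congr 1
  refine Finset.sum_congr rfl fun n hn' => ?_
  rw [integral_const_mul, integral_one_sub_cos_mul_rpow_eq_sin (hn n hn').1 (hn n hn').2 hc]

/-- These are the hypotheses of the integration by parts lemma with β = (N+1)α and γ = Nα. In the
constant α + 2, the α comes from differentiating u^α and the 2 from differentiating 1/u²; it also
covers the bound on the function itself. -/
lemma expTaylorDefect_rpow_div_sq_bounds {α : ℝ} (hα : 0 < α) (N : ℕ) {u : ℝ} (hu : 0 < u) :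
    HasDerivAt (fun u : ℝ => expTaylorDefect (N + 1) (u ^ α) / u ^ 2)
        (-(α * u ^ (α - 3) * expTaylorDefect N (u ^ α))
          - 2 * expTaylorDefect (N + 1) (u ^ α) / u ^ 3) u ∧
      |expTaylorDefect (N + 1) (u ^ α) / u ^ 2| ≤ (α + 2) * u ^ ((N + 1) * α - 2) ∧
      |expTaylorDefect (N + 1) (u ^ α) / u ^ 2| ≤ 2 * u ^ (N * α - 2) ∧
      |-(α * u ^ (α - 3) * expTaylorDefect N (u ^ α))
          - 2 * expTaylorDefect (N + 1) (u ^ α) / u ^ 3| ≤ (α + 2) * u ^ ((N + 1) * α - 3) := by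
  have hs : 0 ≤ u ^ α := Real.rpow_nonneg hu.le _
  have hpow : ∀ n : ℕ, (u ^ α) ^ n = u ^ (n * α) := by
    intro n
    rw [mul_comm, Real.rpow_mul hu.le, Real.rpow_natCast]
  have hfac : ∀ n : ℕ, (1 : ℝ) ≤ (n.factorial : ℝ) := fun n => by
    exact_mod_cast n.factorial_pos
  have hT : ∀ n : ℕ, |expTaylorDefect n (u ^ α)| ≤ u ^ (n * α) := by
    intro n
    refine (abs_expTaylorDefect_le n _ hs).trans ?_
    rw [hpow]
    exact div_le_self (Real.rpow_nonneg hu.le _) (hfac n)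
  have hT' : |expTaylorDefect (N + 1) (u ^ α)| ≤ 2 * u ^ (N * α) := by
    refine (abs_expTaylorDefect_succ_le N hs).trans ?_
    rw [hpow]
    exact div_le_self (mul_nonneg zero_le_two (Real.rpow_nonneg hu.le _)) (hfac N)
  have hT1 := hT (N + 1)
  push_cast at hT1
  have h3 : ∀ x : ℝ, u ^ (x - 3) = u ^ x / u ^ 3 := fun x => by
    rw [Real.rpow_sub hu, show (3 : ℝ) = ((3 : ℕ) : ℝ) by norm_num, Real.rpow_natCast]
  have h2 : ∀ x : ℝ, u ^ (x - 2) = u ^ x / u ^ 2 := fun x => by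
    rw [Real.rpow_sub hu, Real.rpow_two]
  refine ⟨?_, ?_, ?_, ?_⟩
  · have h1 := (hasDerivAt_expTaylorDefect_succ N (u ^ α)).comp u
      (Real.hasDerivAt_rpow_const (p := α) (Or.inl hu.ne'))
    refine (h1.fun_div (hasDerivAt_pow 2 u) (by positivity)).congr_deriv ?_
    rw [h3, Real.rpow_sub_one hu.ne']
    simp only [Function.comp]
    field_simp
    ring
  · rw [abs_div, abs_of_pos (by positivity : 0 < u ^ 2), h2, mul_div_assoc']
    refine div_le_div_of_nonneg_right ?_ (sq_nonneg _)
    nlinarith [Real.rpow_nonneg hu.le ((N + 1) * α)]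
  · rw [abs_div, abs_of_pos (by positivity : 0 < u ^ 2), h2, mul_div_assoc']
    exact div_le_div_of_nonneg_right hT' (sq_nonneg _)
  · have hsplit : u ^ ((N + 1) * α - 3) = u ^ (α - 3) * u ^ (N * α) := by
      rw [← Real.rpow_add hu]
      ring_nf
    refine (abs_sub _ _).trans ?_
    rw [abs_neg, abs_mul, abs_of_nonneg (mul_nonneg hα.le (Real.rpow_nonneg hu.le (α - 3))),
      abs_div, abs_mul, abs_two, abs_of_pos (by positivity : 0 < u ^ 3), add_mul]
    refine add_le_add ?_ ?_
    · rw [hsplit, ← mul_assoc]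
      exact mul_le_mul_of_nonneg_left (hT N) (mul_nonneg hα.le (Real.rpow_nonneg hu.le (α - 3)))
    · rw [h3, mul_div_assoc']
      gcongr

lemma exists_abs_integral_expTaylorDefect_sub_le {α : ℝ} {N : ℕ} (hα : 0 < α) (hN : N * α < 1)
    (h1 : 1 < (N + 1) * α) (h2 : (N + 1) * α < 2) :
    ∃ K : ℝ, 0 ≤ K ∧ ∀ c : ℝ, 0 < c →
      |(∫ u in Ioi (0 : ℝ), (1 - Real.cos (c * u)) * (expTaylorDefect (N + 1) (u ^ α) / u ^ 2))
        - ∫ u in Ioi (0 : ℝ), expTaylorDefect (N + 1) (u ^ α) / u ^ 2|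
        ≤ K * c ^ (1 - (N + 1) * α) := by
  refine ⟨(α + 2) * ∫ u in Ioi (0 : ℝ), |Real.sin u| * u ^ ((N + 1) * α - 3), ?_, fun c hc => ?_⟩
  · refine mul_nonneg (by linarith) (setIntegral_nonneg measurableSet_Ioi fun u hu => ?_)
    exact mul_nonneg (abs_nonneg _) (Real.rpow_nonneg (le_of_lt hu) _)
  · exact (abs_integral_one_sub_cos_mul_sub_le h1 h2 hN hc
      (fun u hu => (expTaylorDefect_rpow_div_sq_bounds hα N hu).1)
      (fun u hu => (expTaylorDefect_rpow_div_sq_bounds hα N hu).2.1)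
      (fun u hu => (expTaylorDefect_rpow_div_sq_bounds hα N hu).2.2.1)
      (fun u hu => (expTaylorDefect_rpow_div_sq_bounds hα N hu).2.2.2)).2

lemma rpow_mul_rpow_scaling {α L t : ℝ} (hα : α ≠ 0) (hL : 0 < L) (ht : 0 < t) (m : ℕ) :
    t ^ (1 / α) * (L * t ^ (-(1 / α))) ^ (1 - m * α) = L ^ (1 - m * α) * t ^ m := by
  rw [Real.mul_rpow hL.le (Real.rpow_nonneg ht.le _), ← Real.rpow_mul ht.le, mul_left_comm,
    ← Real.rpow_add ht, ← Real.rpow_natCast]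
  congr 2
  field_simp
  ring

/-- The defect of index 1 is 1 - e^{-s}. Integrating by parts against -1/u leaves a Gamma integral;
α > 1 makes the boundary term vanish at 0. -/
lemma integral_one_sub_exp_neg_rpow_div_sq {α : ℝ} (hα : 1 < α) :
    ∫ u in Ioi (0 : ℝ), expTaylorDefect 1 (u ^ α) / u ^ 2 = Real.Gamma (1 - 1 / α) := by
  have hα0 : 0 < α := by linarith
  have hd : ∀ u ∈ Ioi (0 : ℝ), HasDerivAt (fun u : ℝ => expTaylorDefect 1 (u ^ α))
      (α * u ^ (α - 1) * Real.exp (-u ^ α)) u := by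
    intro u hu
    refine ((hasDerivAt_expTaylorDefect_succ 0 (u ^ α)).comp u
      (Real.hasDerivAt_rpow_const (p := α) (Or.inl (ne_of_gt hu)))).congr_deriv ?_
    simp [expTaylorDefect]
    ring
  have hv : ∀ u ∈ Ioi (0 : ℝ), HasDerivAt (fun u : ℝ => -u⁻¹) ((u ^ 2)⁻¹) u := by
    intro u hu
    have h := hasDerivAt_inv (ne_of_gt hu : u ≠ 0)
    simpa using h.fun_neg
  have hb := fun u (hu : 0 < u) => expTaylorDefect_rpow_div_sq_bounds hα0 0 hu
  have hcont : ContinuousOn (fun u : ℝ => expTaylorDefect 1 (u ^ α) / u ^ 2) (Ioi 0) :=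
    fun u hu => (hb u hu).1.continuousAt.continuousWithinAt
  have hi : IntegrableOn (fun u : ℝ => expTaylorDefect 1 (u ^ α) / u ^ 2) (Ioi 0) :=
    integrableOn_Ioi_of_rpow_bounds (hcont.aestronglyMeasurable measurableSet_Ioi)
      (by simp; linarith) (by simp) (fun u hu => (hb u hu).2.1) (fun u hu => (hb u hu).2.2.1)
  have hpt : ∀ u ∈ Ioi (0 : ℝ), α * u ^ (α - 1) * Real.exp (-u ^ α) * -u⁻¹
      = -α * (u ^ (α - 2) * Real.exp (-u ^ α)) := by
    intro u hu
    rw [show α - 1 = (α - 2) + 1 by ring, Real.rpow_add_one (ne_of_gt hu)]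
    have : u ≠ 0 := ne_of_gt hu
    field_simp
  have hi' := integrableOn_rpow_mul_exp_neg_rpow (p := α) (s := α - 2) (by linarith) hα0
  have hlim := tendsto_zero_of_abs_le_rpow
    (f := (fun u : ℝ => expTaylorDefect 1 (u ^ α)) * fun u : ℝ => -u⁻¹)
    (A := α + 2) (p := α - 1) (q := -1) (by linarith) (by norm_num) (fun u hu => ?_) (fun u hu => ?_)
  · have key := integral_Ioi_mul_deriv_eq_deriv_mul hd hv hi
      ((integrableOn_congr_fun hpt measurableSet_Ioi).2 (hi'.const_mul (-α))) hlim.1 hlim.2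
    simp only [div_eq_mul_inv]
    rw [key, setIntegral_congr_fun measurableSet_Ioi hpt, integral_const_mul,
      integral_rpow_mul_exp_neg_rpow hα0 (by linarith)]
    rw [show (α - 2 + 1) / α = 1 - α⁻¹ by field_simp; ring]
    field_simp
    simp
  · have h := mul_le_mul_of_nonneg_right (hb u hu).2.1 hu.le
    rw [mul_assoc, ← Real.rpow_add_one hu.ne'] at h
    refine le_trans (le_of_eq ?_) (h.trans_eq ?_)
    · simp only [Pi.mul_apply]
      rw [abs_mul, abs_div, abs_neg, abs_inv, abs_of_pos hu, abs_of_pos (by positivity : 0 < u ^ 2)]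
      field_simp
    · congr 2
      push_cast
      ring
  · have h := mul_le_mul_of_nonneg_right (hb u hu).2.2.1 hu.le
    rw [mul_assoc, ← Real.rpow_add_one hu.ne'] at h
    refine le_trans (le_of_eq ?_) (h.trans ?_)
    · simp only [Pi.mul_apply]
      rw [abs_mul, abs_div, abs_neg, abs_inv, abs_of_pos hu, abs_of_pos (by positivity : 0 < u ^ 2)]
      field_simp
    · norm_num
      gcongr
      linarith

lemma le_rpow_of_le_one_of_le {x u p : ℝ} (hu : 0 < u) (hp0 : 0 ≤ p) (hp1 : p ≤ 1) (h1 : x ≤ 1)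
    (h2 : x ≤ u) : x ≤ u ^ p := by
  rcases le_total u 1 with h | h
  · exact h2.trans (Real.self_le_rpow_of_le_one hu.le h hp1)
  · exact h1.trans (Real.one_le_rpow h hp0)

/-- Both numerators are at most min(1, u), hence at most u^{β-1}. The freedom in β lets these bounds
match those of the Taylor defect. -/
lemma one_sub_exp_neg_div_bounds {β u : ℝ} (hβ1 : 1 ≤ β) (hβ2 : β ≤ 2) (hu : 0 < u) :
    HasDerivAt (fun u : ℝ => (1 - Real.exp (-u)) / u)
        (-((1 - (1 + u) * Real.exp (-u)) / u ^ 2)) u ∧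
      |(1 - Real.exp (-u)) / u| ≤ u ^ (β - 2) ∧
      |-((1 - (1 + u) * Real.exp (-u)) / u ^ 2)| ≤ u ^ (β - 3) := by
  have he := Real.exp_pos (-u)
  have h1 : 1 - u ≤ Real.exp (-u) := by linarith [Real.add_one_le_exp (-u)]
  have h2 : (1 + u) * Real.exp (-u) ≤ 1 := by
    rw [Real.exp_neg, ← div_eq_mul_inv, div_le_one (Real.exp_pos _)]
    linarith [Real.add_one_le_exp u]
  have h3 : Real.exp (-u) ≤ 1 := Real.exp_le_one_iff.2 (by linarith)
  refine ⟨?_, ?_, ?_⟩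
  · have h : HasDerivAt (fun u : ℝ => 1 - Real.exp (-u)) (Real.exp (-u)) u := by
      simpa using (hasDerivAt_neg u).exp.const_sub 1
    refine (h.fun_div (hasDerivAt_id u) hu.ne').congr_deriv ?_
    simp only [id]
    field_simp
    ring
  · rw [abs_of_nonneg (div_nonneg (by linarith) hu.le), div_le_iff₀ hu, ← Real.rpow_add_one hu.ne']
    exact le_rpow_of_le_one_of_le hu (by linarith) (by linarith) (by linarith) (by linarith)
  · rw [abs_neg, abs_of_nonneg (div_nonneg (by linarith) (sq_nonneg _)),
      div_le_iff₀ (by positivity), ← Real.rpow_two, ← Real.rpow_add hu]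
    refine le_rpow_of_le_one_of_le hu (by linarith) (by linarith) ?_ ?_
    · nlinarith
    · nlinarith

lemma abs_half_log_one_add_sq_sub_log_le {c : ℝ} (hc : 0 < c) :
    |1 / 2 * Real.log (1 + c ^ 2) - Real.log c| ≤ (c ^ 2)⁻¹ := by
  have h0 : 0 < (c ^ 2)⁻¹ := by positivity
  have h : 1 / 2 * Real.log (1 + c ^ 2) - Real.log c = 1 / 2 * Real.log (1 + (c ^ 2)⁻¹) := by
    have : 1 + c ^ 2 = c ^ 2 * (1 + (c ^ 2)⁻¹) := by field_simp; ring
    rw [this, Real.log_mul (by positivity) (by positivity), Real.log_pow]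
    push_cast
    ring
  rw [h, abs_of_nonneg (mul_nonneg (by norm_num) (Real.log_nonneg (by linarith)))]
  have := Real.log_le_sub_one_of_pos (by linarith : 0 < 1 + (c ^ 2)⁻¹)
  linarith

/-- The resonant case `N * α = 1`, where the remainder of order `N` produces a logarithm. -/
lemma exists_abs_integral_expTaylorDefect_add_log_le {N : ℕ} (hN : 2 ≤ N) :
    ∃ I K : ℝ, 0 ≤ K ∧ ∀ c : ℝ, 0 < c →
      |(∫ u in Ioi (0 : ℝ), (1 - Real.cos (c * u)) * (expTaylorDefect N (u ^ (1 / (N : ℝ))) / u ^ 2))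
        - (I + (-1) ^ (N - 1) / (N.factorial : ℝ) * Real.log c)|
        ≤ K * c ^ (-(1 / (N : ℝ))) + (c ^ 2)⁻¹ := by
  obtain ⟨M, rfl⟩ : ∃ M, N = M + 1 := ⟨N - 1, by omega⟩
  rw [Nat.add_sub_cancel]
  set N : ℝ := ((M + 1 : ℕ) : ℝ) with hNdef
  have hN2 : (2 : ℝ) ≤ N := by rw [hNdef]; exact_mod_cast hN
  have hM : (M : ℝ) = N - 1 := by rw [hNdef]; push_cast; ring
  set α : ℝ := 1 / N with hαdef
  have hα : 0 < α := by positivity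
  have hNα : N * α = 1 := by rw [hαdef]; field_simp
  have hα1 : α ≤ 1 / 2 := by rw [hαdef]; gcongr
  set e : ℝ := (-1) ^ M / ((M + 1).factorial : ℝ) with hedef
  have he : |e| ≤ 1 := by
    rw [hedef, abs_div, abs_pow, abs_neg, abs_one, one_pow, Nat.abs_cast]
    exact div_le_one_of_le₀ (by exact_mod_cast (M + 1).factorial_pos) (by positivity)
  -- Near 0 the N-th defect over u² behaves like e/u. Removing e · e^{-u}/u makes it integrable at 0
  -- without spoiling the decay at infinity; written with the next defect, as here, the behaviour at
  -- 0 is visible.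
  let h : ℝ → ℝ := fun u => expTaylorDefect (M + 1 + 1) (u ^ α) / u ^ 2
    + e * ((1 - Real.exp (-u)) / u)
  have hsplit : ∀ u : ℝ, 0 < u →
      h u = expTaylorDefect (M + 1) (u ^ α) / u ^ 2 - e * (Real.exp (-u) / u) := by
    intro u hu
    have h1 : (u ^ α) ^ (M + 1) = u := by
      rw [← Real.rpow_natCast, ← Real.rpow_mul hu.le, mul_comm, ← hNdef, hNα, Real.rpow_one]
    simp only [h]
    rw [expTaylorDefect_succ (M + 1), neg_pow, h1, hedef, pow_succ]
    field_simp
    ring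
  have hb1 := fun u (hu : 0 < u) => expTaylorDefect_rpow_div_sq_bounds hα (M + 1) hu
  have hb0 := fun u (hu : 0 < u) => expTaylorDefect_rpow_div_sq_bounds hα M hu
  have hb2 := fun u (hu : 0 < u) => one_sub_exp_neg_div_bounds (β := 1 + α) (by linarith)
    (by linarith) hu
  have hβ : (N + 1) * α = 1 + α := by linarith
  simp only [← hNdef, hβ] at hb1
  simp only [hM] at hb0
  have hγ : (N - 1) * α = 1 - α := by linarith
  rw [hγ] at hb0
  have hmain := fun c (hc : 0 < c) => abs_integral_one_sub_cos_mul_sub_le (h := h)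
    (h' := fun u => (-(α * u ^ (α - 3) * expTaylorDefect (M + 1) (u ^ α))
      - 2 * expTaylorDefect (M + 1 + 1) (u ^ α) / u ^ 3)
      + e * -((1 - (1 + u) * Real.exp (-u)) / u ^ 2))
    -- The defect contributes α + 2 to A and 2 to B; the exponential correction adds 1 to each
    -- because |e| ≤ 1.
    (A := α + 2 + 1) (B := 2 + 1) (β := 1 + α) (γ := 1 - α) (c := c)
    (by linarith) (by linarith) (by linarith) hc
    (fun u hu => (hb1 u hu).1.fun_add ((hb2 u hu).1.const_mul e))
    (fun u hu => by
      refine (abs_add_le _ _).trans ?_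
      rw [add_mul (α + 2), abs_mul]
      exact add_le_add (hb1 u hu).2.1 (mul_le_mul he (hb2 u hu).2.1 (abs_nonneg _) zero_le_one))
    (fun u hu => by
      rw [hsplit u hu]
      refine (abs_sub _ _).trans ?_
      rw [add_mul, abs_mul]
      refine add_le_add (hb0 u hu).2.2.1 (mul_le_mul he ?_ (abs_nonneg _) zero_le_one)
      rw [abs_of_nonneg (by positivity), div_le_iff₀ hu, ← Real.rpow_add_one hu.ne',
        show 1 - α - 2 + 1 = -α by ring, Real.rpow_neg hu.le, Real.exp_neg]
      refine inv_anti₀ (Real.rpow_pos_of_pos hu _) ?_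
      rcases le_total u 1 with hu1 | hu1
      · exact (Real.rpow_le_one hu.le hu1 hα.le).trans (Real.one_le_exp hu.le)
      · refine (Real.rpow_le_rpow_of_exponent_le hu1 (by linarith : α ≤ 1)).trans ?_
        rw [Real.rpow_one]
        linarith [Real.add_one_le_exp u])
    (fun u hu => by
      refine (abs_add_le _ _).trans ?_
      rw [add_mul (α + 2), abs_mul]
      exact add_le_add (hb1 u hu).2.2.2
        (mul_le_mul he (hb2 u hu).2.2 (abs_nonneg _) zero_le_one))
  refine ⟨∫ u in Ioi (0 : ℝ), h u,
    (α + 2 + 1) * ∫ u in Ioi (0 : ℝ), |Real.sin u| * u ^ (1 + α - 3), ?_, fun c hc => ?_⟩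
  · refine mul_nonneg (by linarith) (setIntegral_nonneg measurableSet_Ioi fun u hu => ?_)
    exact mul_nonneg (abs_nonneg _) (Real.rpow_nonneg (le_of_lt hu) _)
  · obtain ⟨hi, hle⟩ := hmain c hc
    obtain ⟨gi, ge⟩ := integral_one_sub_cos_mul_exp_neg_div c
    have hpt : ∀ u ∈ Ioi (0 : ℝ),
        (1 - Real.cos (c * u)) * (expTaylorDefect (M + 1) (u ^ α) / u ^ 2)
        = (1 - Real.cos (c * u)) * h u + e * ((1 - Real.cos (c * u)) * (Real.exp (-u) / u)) := by
      intro u hu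
      rw [hsplit u hu]
      ring
    rw [setIntegral_congr_fun measurableSet_Ioi hpt, integral_add hi (gi.const_mul e),
      integral_const_mul, ge]
    rw [show 1 - (1 + α) = -α by ring] at hle
    have hlog := abs_half_log_one_add_sq_sub_log_le hc
    have hlog' : |e * (1 / 2 * Real.log (1 + c ^ 2) - Real.log c)| ≤ (c ^ 2)⁻¹ := by
      rw [abs_mul]
      exact (mul_le_of_le_one_left (abs_nonneg _) he).trans hlog
    refine le_trans (le_of_eq ?_) ((abs_add_le _ _).trans (add_le_add hle hlog'))
    congr 1
    ring

/-! ### Expansions of the heat content -/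

lemma heat_expansion_of_one_lt {α : ℝ} (h1 : 1 < α) (h2 : α ≤ 2) {a b : ℝ} (hab : a < b) :
    ∃ C : ℝ, 0 < C ∧ ∀ Y : StableProcess.{u} α, ∀ t : ℝ≥0, 0 < t →
      |(Y.heat (Set.Ioo a b) (Set.Ioo a b)ᶜ t).toReal
          - 2 / Real.pi * Real.Gamma (1 - 1 / α) * (t : ℝ) ^ (1 / α)|
        ≤ C * ((t : ℝ) * Set.indicator (Set.Ioo (1 : ℝ) 2) 1 α
            + (t : ℝ) ^ (3 / 2 : ℝ) * Set.indicator ({2} : Set ℝ) 1 α) := by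
  have hL : 0 < b - a := sub_pos.2 hab
  have hπ := Real.pi_pos
  rcases h2.lt_or_eq with h2 | rfl
  · have hα : 0 < α := by linarith
    obtain ⟨K, hK0, hK⟩ := exists_abs_integral_expTaylorDefect_sub_le (N := 0) hα (by simp)
      (by simpa using h1) (by simpa using h2)
    -- K may vanish, so 1 is added to keep the constant positive.
    refine ⟨2 / Real.pi * K * (b - a) ^ (1 - α) + 1, by positivity, fun Y t ht => ?_⟩
    have ht' : (0 : ℝ) < t := by positivity
    have hc : 0 < (b - a) * (t : ℝ) ^ (-(1 / α)) := mul_pos hL (Real.rpow_pos_of_pos ht' _)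
    rw [Y.toReal_heat_eq hα hab ht, stableIntegral_eq_sum_add (N := 0) hα (by simp) hc]
    have hKc := hK _ hc
    have hsc := rpow_mul_rpow_scaling hα.ne' hL ht' 1
    simp only [Nat.cast_zero, zero_add, one_mul, Nat.cast_one, pow_one,
      integral_one_sub_exp_neg_rpow_div_sq h1] at hKc hsc
    have hind1 : Set.indicator (Set.Ioo (1 : ℝ) 2) (1 : ℝ → ℝ) α = 1 := by
      rw [indicator_of_mem (show α ∈ Ioo (1 : ℝ) 2 from ⟨h1, h2⟩), Pi.one_apply]
    have hind2 : Set.indicator ({2} : Set ℝ) (1 : ℝ → ℝ) α = 0 :=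
      indicator_of_notMem (by simpa using h2.ne) _
    rw [hind1, hind2, mul_one, mul_zero, add_zero]
    simp only [Finset.Icc_eq_empty (by norm_num : ¬ 1 ≤ 0), Finset.sum_empty, zero_add]
    set J := ∫ u in Ioi (0 : ℝ), (1 - Real.cos ((b - a) * (t : ℝ) ^ (-(1 / α)) * u))
      * (expTaylorDefect 1 (u ^ α) / u ^ 2)
    have htp : 0 < (t : ℝ) ^ (1 / α) := Real.rpow_pos_of_pos ht' _
    calc |2 / Real.pi * ((t : ℝ) ^ (1 / α) * J)
          - 2 / Real.pi * Real.Gamma (1 - 1 / α) * (t : ℝ) ^ (1 / α)|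
        = 2 / Real.pi * (t : ℝ) ^ (1 / α) * |J - Real.Gamma (1 - 1 / α)| := by
          rw [← abs_of_pos (by positivity : 0 < 2 / Real.pi * (t : ℝ) ^ (1 / α)), ← abs_mul]
          ring_nf
      _ ≤ 2 / Real.pi * (t : ℝ) ^ (1 / α) * (K * ((b - a) * (t : ℝ) ^ (-(1 / α))) ^ (1 - α)) := by
          gcongr
      _ = 2 / Real.pi * K * (b - a) ^ (1 - α) * t := by
          rw [mul_mul_mul_comm, hsc]
          ring
      _ ≤ _ := by nlinarith
  · refine ⟨8 / √Real.pi / (b - a) ^ 2, by positivity, fun Y t ht => ?_⟩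
    obtain ⟨ν, hν, hchar, hheat⟩ := Y.exists_law_heat t
    have hlaw : ν = gaussianReal 0 (2 * t) := by
      refine Measure.ext_of_charFun (funext fun ξ => ?_)
      rw [hchar, charFun_gaussianReal, Real.rpow_two, sq_abs]
      push_cast
      congr 1
      ring
    have hind1 : Set.indicator (Set.Ioo (1 : ℝ) 2) (1 : ℝ → ℝ) 2 = 0 :=
      indicator_of_notMem (by simp) _
    have hind2 : Set.indicator ({2} : Set ℝ) (1 : ℝ → ℝ) 2 = 1 := by simp
    have hΓ : 2 / Real.pi * Real.Gamma (1 - 1 / 2) = 2 / √Real.pi := by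
      rw [show (1 : ℝ) - 1 / 2 = 1 / 2 by norm_num, Real.Gamma_one_half_eq]
      nth_rewrite 1 [← Real.mul_self_sqrt hπ.le]
      field_simp
    rw [hheat a b hab, hlaw, hind1, hind2, mul_one, mul_zero, zero_add, hΓ]
    exact abs_integral_min_abs_gaussianReal_sub_le ht hL

lemma heat_eq_of_cauchy {a b : ℝ} (hab : a < b) (Y : StableProcess.{u} 1) {t : ℝ≥0} (ht : 0 < t) :
    (Y.heat (Set.Ioo a b) (Set.Ioo a b)ᶜ t).toReal
      = 2 / Real.pi * t * Real.log (1 / t)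
        + 2 / Real.pi * ((b - a) * Real.arctan (t / (b - a))
            + 1 / 2 * t * Real.log ((t : ℝ) ^ 2 + (b - a) ^ 2)) := by
  have hL : 0 < b - a := sub_pos.2 hab
  have ht' : (0 : ℝ) < t := by positivity
  have hlog : Real.log (1 + ((b - a) * (t : ℝ)⁻¹) ^ 2)
      = Real.log ((t : ℝ) ^ 2 + (b - a) ^ 2) - 2 * Real.log t := by
    rw [show 1 + ((b - a) * (t : ℝ)⁻¹) ^ 2 = ((t : ℝ) ^ 2 + (b - a) ^ 2) / (t : ℝ) ^ 2 by
      field_simp, Real.log_div (by positivity) (by positivity), Real.log_pow]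
    push_cast
    ring
  rw [Y.toReal_heat_eq one_pos hab ht, stableIntegral]
  simp only [Real.rpow_one, div_one, Real.rpow_neg_one]
  rw [integral_one_sub_cos_mul_one_sub_exp_neg_div_sq (by positivity), hlog,
    one_div_mul_eq_div, one_div (t : ℝ), Real.log_inv,
    show 1 / ((b - a) * (t : ℝ)⁻¹) = t / (b - a) by field_simp]
  field_simp
  ring

lemma heat_expansion_of_lt_one {α : ℝ} (hα : 0 < α) (h1 : α < 1) (hk : ∀ k : ℕ, 1 / α ≠ k) :
    ∃ Cα : ℝ, ∀ a b : ℝ, a < b →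
      ∃ C : ℝ, 0 < C ∧ ∀ Y : StableProcess.{u} α, ∀ t : ℝ≥0, 0 < t →
        |(Y.heat (Set.Ioo a b) (Set.Ioo a b)ᶜ t).toReal
            - (2 / Real.pi * ∑ n ∈ Finset.Icc 1 ⌊1 / α⌋₊,
                  (-1 : ℝ) ^ (n - 1)
                    * (Real.Gamma (n * α) / ((1 - n * α) * (n.factorial : ℝ)))
                    * (b - a) ^ (1 - n * α) * Real.sin (Real.pi * n * α / 2) * (t : ℝ) ^ n
                + Cα * (t : ℝ) ^ (1 / α))|
          ≤ C * (t : ℝ) ^ (⌊1 / α⌋₊ + 1) := by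
  have hπ := Real.pi_pos
  set N := ⌊1 / α⌋₊ with hNdef
  have hN : N * α < 1 := by
    have : (N : ℝ) < 1 / α := lt_of_le_of_ne (Nat.floor_le (by positivity)) (hk N).symm
    rwa [lt_div_iff₀ hα] at this
  have hN1 : 1 < (N + 1) * α := by
    have := Nat.lt_floor_add_one (1 / α)
    rwa [div_lt_iff₀ hα] at this
  obtain ⟨K, hK0, hK⟩ := exists_abs_integral_expTaylorDefect_sub_le hα hN hN1 (by linarith)
  -- The constant is chosen before the interval: the plain integral of the remainder does not
  -- involve c.
  refine ⟨2 / Real.pi * ∫ u in Ioi (0 : ℝ), expTaylorDefect (N + 1) (u ^ α) / u ^ 2,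
    fun a b hab => ?_⟩
  have hL : 0 < b - a := sub_pos.2 hab
  refine ⟨2 / Real.pi * K * (b - a) ^ (1 - (N + 1) * α) + 1, by positivity, fun Y t ht => ?_⟩
  have ht' : (0 : ℝ) < t := by positivity
  have hc : 0 < (b - a) * (t : ℝ) ^ (-(1 / α)) := mul_pos hL (Real.rpow_pos_of_pos ht' _)
  rw [Y.toReal_heat_eq hα hab ht, stableIntegral_eq_sum_add hα hN hc]
  have hKc := hK _ hc
  have hsc := rpow_mul_rpow_scaling hα.ne' hL ht' (N + 1)
  push_cast at hsc
  have hsum : (t : ℝ) ^ (1 / α) * ∑ n ∈ Finset.Icc 1 N, (-1) ^ (n - 1) / (n.factorial : ℝ)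
        * (((b - a) * (t : ℝ) ^ (-(1 / α))) ^ (1 - n * α)
          * (Real.Gamma (n * α) / (1 - n * α) * Real.sin (Real.pi * (n * α) / 2)))
      = ∑ n ∈ Finset.Icc 1 N, (-1 : ℝ) ^ (n - 1)
          * (Real.Gamma (n * α) / ((1 - n * α) * (n.factorial : ℝ)))
          * (b - a) ^ (1 - n * α) * Real.sin (Real.pi * n * α / 2) * (t : ℝ) ^ n := by
    rw [Finset.mul_sum]
    refine Finset.sum_congr rfl fun n _ => ?_
    have := rpow_mul_rpow_scaling hα.ne' hL ht' n
    rw [mul_left_comm, ← mul_assoc ((t : ℝ) ^ (1 / α)), this, ← mul_assoc Real.pi, div_mul_eq_div_div]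
    ring
  rw [mul_add ((t : ℝ) ^ (1 / α)), hsum]
  set J := ∫ u in Ioi (0 : ℝ), (1 - Real.cos ((b - a) * (t : ℝ) ^ (-(1 / α)) * u))
    * (expTaylorDefect (N + 1) (u ^ α) / u ^ 2)
  set I := ∫ u in Ioi (0 : ℝ), expTaylorDefect (N + 1) (u ^ α) / u ^ 2
  set S := ∑ n ∈ Finset.Icc 1 N, (-1 : ℝ) ^ (n - 1)
          * (Real.Gamma (n * α) / ((1 - n * α) * (n.factorial : ℝ)))
          * (b - a) ^ (1 - n * α) * Real.sin (Real.pi * n * α / 2) * (t : ℝ) ^ n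
  have htp : 0 < (t : ℝ) ^ (1 / α) := Real.rpow_pos_of_pos ht' _
  calc |2 / Real.pi * (S + (t : ℝ) ^ (1 / α) * J)
        - (2 / Real.pi * S + 2 / Real.pi * I * (t : ℝ) ^ (1 / α))|
      = 2 / Real.pi * (t : ℝ) ^ (1 / α) * |J - I| := by
        rw [← abs_of_pos (by positivity : 0 < 2 / Real.pi * (t : ℝ) ^ (1 / α)), ← abs_mul]
        ring_nf
    _ ≤ 2 / Real.pi * (t : ℝ) ^ (1 / α)
          * (K * ((b - a) * (t : ℝ) ^ (-(1 / α))) ^ (1 - (N + 1) * α)) := by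
        gcongr
    _ = 2 / Real.pi * K * (b - a) ^ (1 - (N + 1) * α) * (t : ℝ) ^ (N + 1) := by
        rw [mul_mul_mul_comm, hsc]
        ring
    _ ≤ _ := by
        have : 0 ≤ (t : ℝ) ^ (N + 1) := by positivity
        nlinarith

lemma heat_expansion_of_eq_one_div {N : ℕ} (hN : 2 ≤ N) {a b : ℝ} (hab : a < b) :
    ∃ CN : ℝ, ∃ C : ℝ, 0 < C ∧ ∀ Y : StableProcess.{u} (1 / (N : ℝ)), ∀ t : ℝ≥0, 0 < t →
      (t : ℝ) < 1 →
      |(Y.heat (Set.Ioo a b) (Set.Ioo a b)ᶜ t).toReal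
          - (2 / Real.pi * ∑ n ∈ Finset.Icc 1 (N - 1),
                (-1 : ℝ) ^ (n - 1)
                  * (Real.Gamma (n / N) / ((1 - (n : ℝ) / N) * (n.factorial : ℝ)))
                  * (b - a) ^ (1 - (n : ℝ) / N) * Real.sin (Real.pi * n / (2 * N)) * (t : ℝ) ^ n
              + (-1 : ℝ) ^ (N - 1) * (2 / (Real.pi * ((N - 1).factorial : ℝ)))
                  * (t : ℝ) ^ N * Real.log (1 / t)
              + CN * (t : ℝ) ^ N)|
        ≤ C * (t : ℝ) ^ (N + 1) := by
  have hπ := Real.pi_pos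
  have hL : 0 < b - a := sub_pos.2 hab
  have hN0 : (0 : ℝ) < N := by positivity
  obtain ⟨I, K, hK0, hK⟩ := exists_abs_integral_expTaylorDefect_add_log_le hN
  set e : ℝ := (-1) ^ (N - 1) / (N.factorial : ℝ) with hedef
  set α : ℝ := 1 / N with hαdef
  -- Since log c = log(b - a) + N log(1/t), the length enters the coefficient of t^N through its
  -- logarithm.
  refine ⟨2 / Real.pi * (I + e * Real.log (b - a)),
    2 / Real.pi * (K * (b - a) ^ (-α) + ((b - a) ^ 2)⁻¹), by positivity,
    fun Y t ht ht1 => ?_⟩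
  have ht' : (0 : ℝ) < t := by positivity
  have hα : 0 < α := by positivity
  have hαN : 1 / α = N := by rw [hαdef, one_div_one_div]
  have hNα : N * α = 1 := by rw [hαdef]; field_simp
  have hc : 0 < (b - a) * (t : ℝ) ^ (-(1 / α)) := mul_pos hL (Real.rpow_pos_of_pos ht' _)
  have hN1 : ((N - 1 : ℕ) : ℝ) * α < 1 := by
    rw [← hNα]
    gcongr
    omega
  have hsum : (t : ℝ) ^ (1 / α) * ∑ n ∈ Finset.Icc 1 (N - 1), (-1) ^ (n - 1) / (n.factorial : ℝ)
        * (((b - a) * (t : ℝ) ^ (-(1 / α))) ^ (1 - n * α)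
          * (Real.Gamma (n * α) / (1 - n * α) * Real.sin (Real.pi * (n * α) / 2)))
      = ∑ n ∈ Finset.Icc 1 (N - 1), (-1 : ℝ) ^ (n - 1)
          * (Real.Gamma (n / N) / ((1 - (n : ℝ) / N) * (n.factorial : ℝ)))
          * (b - a) ^ (1 - (n : ℝ) / N) * Real.sin (Real.pi * n / (2 * N)) * (t : ℝ) ^ n := by
    rw [Finset.mul_sum]
    refine Finset.sum_congr rfl fun n _ => ?_
    have := rpow_mul_rpow_scaling hα.ne' hL ht' n
    rw [mul_left_comm, ← mul_assoc ((t : ℝ) ^ (1 / α)), this,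
      show (n : ℝ) * α = n / N by rw [hαdef]; ring,
      show Real.pi * (n / N) / 2 = Real.pi * n / (2 * N) by field_simp, div_mul_eq_div_div (Real.Gamma _)]
    ring
  have hlog : Real.log ((b - a) * (t : ℝ) ^ (-(1 / α))) = Real.log (b - a) + N * Real.log (1 / t) := by
    rw [Real.log_mul hL.ne' (Real.rpow_pos_of_pos ht' _).ne', Real.log_rpow ht', hαN, one_div,
      Real.log_inv]
    ring
  have hfac : e * N = (-1) ^ (N - 1) * (1 / ((N - 1).factorial : ℝ)) := by
    rw [hedef, ← Nat.mul_factorial_pred (by omega : N ≠ 0)]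
    push_cast
    field_simp
  have hpow : ((b - a) * (t : ℝ) ^ (-(1 / α))) ^ (-α) = (b - a) ^ (-α) * t := by
    rw [Real.mul_rpow hL.le (Real.rpow_nonneg ht'.le _), ← Real.rpow_mul ht'.le, neg_mul_neg,
      one_div_mul_cancel hα.ne', Real.rpow_one]
  have htN : (t : ℝ) ^ (1 / α) = (t : ℝ) ^ N := by rw [hαN, Real.rpow_natCast]
  -- Here c^{-2} = (b - a)^{-2} t^{2N}, and t^{2N} ≤ t because t < 1.
  have hinv : (((b - a) * (t : ℝ) ^ (-(1 / α))) ^ 2)⁻¹ ≤ ((b - a) ^ 2)⁻¹ * t := by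
    rw [Real.rpow_neg ht'.le, htN, mul_pow, mul_inv, inv_pow, inv_inv]
    gcongr
    rw [← pow_mul]
    exact pow_le_of_le_one ht'.le ht1.le (by omega)
  have hKc := hK _ hc
  rw [hlog, hpow] at hKc
  rw [Y.toReal_heat_eq hα hab ht, stableIntegral_eq_sum_add hα hN1 hc,
    mul_add ((t : ℝ) ^ (1 / α)), hsum, Nat.sub_add_cancel (by omega : 1 ≤ N), htN]
  set J := ∫ u in Ioi (0 : ℝ), (1 - Real.cos ((b - a) * (t : ℝ) ^ (-(1 / α)) * u))
    * (expTaylorDefect N (u ^ α) / u ^ 2)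
  set S := ∑ n ∈ Finset.Icc 1 (N - 1), (-1 : ℝ) ^ (n - 1)
          * (Real.Gamma (n / N) / ((1 - (n : ℝ) / N) * (n.factorial : ℝ)))
          * (b - a) ^ (1 - (n : ℝ) / N) * Real.sin (Real.pi * n / (2 * N)) * (t : ℝ) ^ n
  have hcoef : (-1 : ℝ) ^ (N - 1) * (2 / (Real.pi * ((N - 1).factorial : ℝ)))
      = 2 / Real.pi * (e * N) := by
    rw [hfac]
    field_simp
  rw [hcoef]
  calc |2 / Real.pi * (S + (t : ℝ) ^ N * J) - (2 / Real.pi * S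
        + 2 / Real.pi * (e * N) * (t : ℝ) ^ N * Real.log (1 / t)
        + 2 / Real.pi * (I + e * Real.log (b - a)) * (t : ℝ) ^ N)|
      = 2 / Real.pi * (t : ℝ) ^ N
          * |J - (I + e * (Real.log (b - a) + N * Real.log (1 / t)))| := by
        rw [← abs_of_pos (by positivity : 0 < 2 / Real.pi * (t : ℝ) ^ N), ← abs_mul]
        ring_nf
    _ ≤ 2 / Real.pi * (t : ℝ) ^ N * (K * ((b - a) ^ (-α) * t) + ((b - a) ^ 2)⁻¹ * t) := by
        gcongr
        exact hKc.trans (add_le_add le_rfl hinv)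
    _ = _ := by ring

theorem mainTheorem3 :
    -- the case `1 < α ≤ 2`
    (∀ α : ℝ, 1 < α → α ≤ 2 → ∀ a b : ℝ, a < b →
      ∃ C : ℝ, 0 < C ∧ ∀ Y : StableProcess.{u} α, ∀ t : ℝ≥0, 0 < t →
        |(Y.heat (Set.Ioo a b) (Set.Ioo a b)ᶜ t).toReal
            - 2 / Real.pi * Real.Gamma (1 - 1 / α) * (t : ℝ) ^ (1 / α)|
          ≤ C * ((t : ℝ) * Set.indicator (Set.Ioo (1 : ℝ) 2) 1 α
              + (t : ℝ) ^ (3 / 2 : ℝ) * Set.indicator ({2} : Set ℝ) 1 α)) ∧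
    -- the case `α = 1`
    (∀ a b : ℝ, a < b → ∀ Y : StableProcess.{u} 1, ∀ t : ℝ≥0, 0 < t →
      (Y.heat (Set.Ioo a b) (Set.Ioo a b)ᶜ t).toReal
        = 2 / Real.pi * t * Real.log (1 / t)
          + 2 / Real.pi * ((b - a) * Real.arctan (t / (b - a))
              + 1 / 2 * t * Real.log ((t : ℝ) ^ 2 + (b - a) ^ 2))) ∧
    -- the case `0 < α < 1` with `1 / α` not an integer
    (∀ α : ℝ, 0 < α → α < 1 → (∀ k : ℕ, 1 / α ≠ k) →
      ∃ Cα : ℝ, ∀ a b : ℝ, a < b →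
        ∃ C : ℝ, 0 < C ∧ ∀ Y : StableProcess.{u} α, ∀ t : ℝ≥0, 0 < t →
          (t : ℝ) < min ((b - a) ^ α) (Real.exp (-1)) →
          |(Y.heat (Set.Ioo a b) (Set.Ioo a b)ᶜ t).toReal
              - (2 / Real.pi * ∑ n ∈ Finset.Icc 1 ⌊1 / α⌋₊,
                    (-1 : ℝ) ^ (n - 1)
                      * (Real.Gamma (n * α) / ((1 - n * α) * (n.factorial : ℝ)))
                      * (b - a) ^ (1 - n * α) * Real.sin (Real.pi * n * α / 2) * (t : ℝ) ^ n
                  + Cα * (t : ℝ) ^ (1 / α))|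
            ≤ C * (t : ℝ) ^ (⌊1 / α⌋₊ + 1)) ∧
    -- the case `0 < α < 1` with `α = 1 / N`
    (∀ N : ℕ, 2 ≤ N → ∀ a b : ℝ, a < b →
      ∃ CN : ℝ, ∃ C : ℝ, 0 < C ∧ ∀ Y : StableProcess.{u} (1 / (N : ℝ)), ∀ t : ℝ≥0, 0 < t →
        (t : ℝ) < min ((b - a) ^ (1 / (N : ℝ))) (Real.exp (-1)) →
        |(Y.heat (Set.Ioo a b) (Set.Ioo a b)ᶜ t).toReal
            - (2 / Real.pi * ∑ n ∈ Finset.Icc 1 (N - 1),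
                  (-1 : ℝ) ^ (n - 1)
                    * (Real.Gamma (n / N) / ((1 - (n : ℝ) / N) * (n.factorial : ℝ)))
                    * (b - a) ^ (1 - (n : ℝ) / N) * Real.sin (Real.pi * n / (2 * N)) * (t : ℝ) ^ n
                + (-1 : ℝ) ^ (N - 1) * (2 / (Real.pi * ((N - 1).factorial : ℝ)))
                    * (t : ℝ) ^ N * Real.log (1 / t)
                + CN * (t : ℝ) ^ N)|
          ≤ C * (t : ℝ) ^ (N + 1)) := by
  refine ⟨fun α h1 h2 a b hab => heat_expansion_of_one_lt h1 h2 hab,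
    fun a b hab Y t ht => heat_eq_of_cauchy hab Y ht, fun α hα h1 hk => ?_, fun N hN a b hab => ?_⟩
  · obtain ⟨Cα, h⟩ := heat_expansion_of_lt_one hα h1 hk
    refine ⟨Cα, fun a b hab => ?_⟩
    obtain ⟨C, hC, h⟩ := h a b hab
    exact ⟨C, hC, fun Y t ht _ => h Y t ht⟩
  · obtain ⟨CN, C, hC, h⟩ := heat_expansion_of_eq_one_div hN hab
    exact ⟨CN, C, hC, fun Y t ht ht1 => h Y t ht
      ((ht1.trans_le (min_le_right _ _)).trans (Real.exp_lt_one_iff.2 (by norm_num)))⟩
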